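/- **Problem.** Let $G=(V,E)$ be a connected simple graph with $n$ nodes. Traversing an edge $\{u,v\}\in E$ from $u$ to $v$ costs $w(u,v)\in\mathbb{Z}_{\ge 1}$ per unit, where $w(u,v)\ne w(v,u)$ is allowed. Let $b\in\mathbb{Z}^V$ be a demand vector with $\sum_v b_v=0$. A *flow* is a function $x$ on arcs (directed edges) with $x(u,v)=-x(v,u)$ and $\sum_{u:\{u,v\}\in E}x(u,v)=b_v$ for all $v$; its cost is $c(x)=\sum_{(u,v)}\max\{0,w(u,v)\,x(u,v)\}$, the sum being over all arcs. The shortest transshipment problem asks for $\mathrm{OPT}=\min\{c(x): x \text{ a flow}\}$. A *dual solution* is a vector $y\in\mathbb{R}^V$ with $y_v-y_u\le w(u,v)$ for every arc $(u,v)$, and its value is $b^{T}y$. Let $\lambda=\max\{w(u,v)/w(v,u)\}\ge 1$, the maximum being over all arcs ($\lambda=1$ for symmetric weights, and also if there are no edges). **Model.** In the broadcast congested clique, the $n$ nodes carry unique identifiers. Initially each node knows only its own identifier, its incident edges (given by the identifiers of the other endpoints) with their weights in both directions, its demand $b_v$, and $\varepsilon$. In every synchronous round each node performs arbitrary local computation,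 broadcasts one message of $O(\log n)$ bits to all nodes, and receives the messages of all other nodes (tagged by their senders' identifiers). Identifiers, weights and $|b_v|$ are at most $n^{c}$ for some constant $c$ (polynomially bounded). **Theorem.** There are a constant $k$ and a single deterministic broadcast congested clique algorithm such that, for every constant $c$, there is a constant $C$ for which the following holds. For every $n$, every instance whose identifiers, weights and demands are bounded by $n^c$ as above, and every $0<\varepsilon\le 1$, all messages of the algorithm have $O(\log n)$ bits (with a constant that depends only on $c$; formally $O(1+\log n)$), all nodes terminate within $$C\,(1+\log n)^k\,\varepsilon^{-3}\,\lambda^4(1+\log\lambda)$$ rounds, and their outputs determine a flow $x$ and a dual solution $y$ with $$c(x)\le(1+\varepsilon)\,b^{T}y .$$ In particular $c(x)\le(1+\varepsilon)c(x')$ for every flow $x'$ and $b^{T}y'\le(1+\varepsilon)b^{T}y$ for every dual solution $y'$. At termination each node knows $x$ on its incident edges, all of $y$, and a number $z$ with $\mathrm{OPT}\le z\le(1+\varepsilon)\mathrm{OPT}$. For symmetric weights the number of rounds is thus $\tilde O(\varepsilon^{-3})$, and asymmetric weights cost an additional factor of $\lambda^4(1+\log\lambda)$. -/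

import Mathlib

namespace BroadcastClique

/-- The asymmetric norm `p(v) = ∑ᵢ max {0, vᵢ}`. -/
noncomputable def pNorm {ι : Type} [Fintype ι] (v : ι → ℝ) : ℝ :=
  ∑ i, max 0 (v i)

/-- The asymmetric norm `q(v) = max {0, maxᵢ vᵢ}` (it is `0` if there is no index). -/
noncomputable def qNorm {ι : Type} [Fintype ι] (v : ι → ℝ) : ℝ :=
  max 0 (⨆ i, v i)

/-- An input of the shortest transshipment problem in a network of `n` nodes: a connected simple
graph, node identifiers, positive integral traversal costs (`weight u v` is the cost of
traversing the edge `{u, v}` from `u` to `v`; only its values on edges matter), and integral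
demands (positive at sinks, negative at sources) that sum to zero. -/
structure Transshipment (n : ℕ) where
  graph : SimpleGraph (Fin n)
  connected : graph.Connected
  ident : Fin n → ℕ
  ident_injective : Function.Injective ident
  weight : Fin n → Fin n → ℕ
  weight_pos : ∀ u v, graph.Adj u v → 1 ≤ weight u v
  demand : Fin n → ℤ
  demand_sum : ∑ v, demand v = 0

/-- The part of the input that a single node holds: its own identifier, its incident edges, its
demand and the accuracy `ε`. An incident edge of `v` is given as a triple (identifier of the other
endpoint `u`, cost from `v` to `u`, cost from `u` to `v`). -/
structure NodeInput where
  ident : ℕ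
  edges : Finset (ℕ × ℕ × ℕ)
  demand : ℤ
  eps : ℝ

/-- What a single node outputs: an estimate of the optimum value, the potentials of the dual
solution (indexed by node identifiers), and the net flow that the primal solution sends from this
node to each of its neighbours (indexed by the neighbour's identifier). -/
structure NodeOutput where
  value : ℝ
  potential : ℕ → ℝ
  flow : ℕ → ℝ

/-- A deterministic algorithm for the broadcast congested clique, run by every node. Local
computation is unrestricted. A node starts in the state `init` of its local input; it broadcasts
the bit string `message` of its current state, and moves on with `step` according to the set of
pairs (sender's identifier, message) received from the other nodes. It terminates as soon as
`output` of its state is defined. -/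
structure Algorithm where
  State : Type
  init : NodeInput → State
  message : State → List Bool
  step : State → Finset (ℕ × List Bool) → State
  output : State → Option NodeOutput

namespace Transshipment

variable {n : ℕ} (I : Transshipment n)

open Classical in
/-- The local input of node `v`. -/
noncomputable def nodeInput (ε : ℝ) (v : Fin n) : NodeInput where
  ident := I.ident v
  edges := (Finset.univ.filter fun u => I.graph.Adj v u).image
    fun u => (I.ident u, I.weight v u, I.weight u v)
  demand := I.demand v
  eps := ε

/-- Identifiers, weights and demands are bounded by `n ^ c`. -/
def PolyBounded (c : ℕ) : Prop :=
  (∀ v, I.ident v ≤ n ^ c) ∧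
  (∀ u v, I.graph.Adj u v → I.weight u v ≤ n ^ c) ∧
  (∀ v, |I.demand v| ≤ (n : ℤ) ^ c)

/-- The cost of an arc (an edge with a direction), as a real number. -/
def arcCost (a : I.graph.Dart) : ℝ := (I.weight a.fst a.snd : ℝ)

/-- The maximum `lam ≥ 1` over all edges of the cost ratio between the two directions. -/
noncomputable def lam : ℝ :=
  max 1 (⨆ a : I.graph.Dart, I.arcCost a / I.arcCost a.symm)

open Classical in
/-- Primal feasibility. `x a` is the net flow along the arc `a`, so it changes its sign with the
direction of the arc; into every node `v` there is a net flow of `demand v`. -/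
def IsFlow (x : I.graph.Dart → ℝ) : Prop :=
  (∀ a, x a.symm = - x a) ∧
  ∀ v, ∑ a : I.graph.Dart with a.snd = v, x a = (I.demand v : ℝ)

open Classical in
/-- The cost of a flow: on each edge, the flow pays for the direction in which it is sent. -/
noncomputable def cost (x : I.graph.Dart → ℝ) : ℝ :=
  pNorm fun a : I.graph.Dart => I.arcCost a * x a

open Classical in
/-- Dual feasibility: the stretch of no arc exceeds `1`. -/
def IsPotential (y : Fin n → ℝ) : Prop :=
  qNorm (fun a : I.graph.Dart => (y a.snd - y a.fst) / I.arcCost a) ≤ 1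

/-- The dual objective `bᵀy`. -/
def dualValue (y : Fin n → ℝ) : ℝ := ∑ v, (I.demand v : ℝ) * y v

/-- The optimum value of the shortest transshipment problem. -/
noncomputable def opt : ℝ := sInf (I.cost '' {x | I.IsFlow x})

/-- The outputs of the nodes together form a `(1 + ε)`-approximate primal solution `x` and a
`(1 + ε)`-approximate dual solution `y`: each node knows the flow on its incident
edges, all potentials, and a `(1 + ε)`-approximation of the optimum value. -/
def IsApproxSolution (ε : ℝ) (out : Fin n → NodeOutput) : Prop :=
  ∃ (x : I.graph.Dart → ℝ) (y : Fin n → ℝ),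
    (∀ a : I.graph.Dart, (out a.fst).flow (I.ident a.snd) = x a) ∧
    (∀ v u, (out v).potential (I.ident u) = y u) ∧
    I.IsFlow x ∧ I.IsPotential y ∧
    I.cost x ≤ (1 + ε) * I.dualValue y ∧
    (∀ x', I.IsFlow x' → I.cost x ≤ (1 + ε) * I.cost x') ∧
    (∀ y', I.IsPotential y' → I.dualValue y' ≤ (1 + ε) * I.dualValue y) ∧
    ∀ v, I.opt ≤ (out v).value ∧ (out v).value ≤ (1 + ε) * I.opt

end Transshipment

namespace Algorithm

variable (alg : Algorithm)

/-- The bit string that a node in state `s` broadcasts; terminated nodes stay silent. -/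
def sent (s : alg.State) : List Bool :=
  if (alg.output s).isSome then [] else alg.message s

/-- The messages that node `v` receives if the nodes are in the states `σ`. -/
def received {n : ℕ} (I : Transshipment n) (σ : Fin n → alg.State) (v : Fin n) :
    Finset (ℕ × List Bool) :=
  (Finset.univ.filter fun u => u ≠ v).image fun u => (I.ident u, alg.sent (σ u))

/-- The states of all nodes after `t` synchronous rounds. -/
noncomputable def run {n : ℕ} (I : Transshipment n) (ε : ℝ) : ℕ → Fin n → alg.State
  | 0 => fun v => alg.init (I.nodeInput ε v)
  | t + 1 => fun v =>
      if (alg.output (run I ε t v)).isSome then run I ε t v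
      else alg.step (run I ε t v) (alg.received I (run I ε t) v)

end Algorithm

end BroadcastClique

namespace BroadcastClique


/-! The dual problem is relaxed until every node can solve it alone, and the multiplicative weights
method repairs the relaxation. The constraints kept are those on the arcs of a spanner, which all
nodes know, and one weighted average of the constraints on all arcs. This average is determined by
three numbers per node: the total weight coming in, the total weight going out, and the outgoing
weight multiplied by costs.

By linear programming duality (`lp_duality`, `Transshipment.exists_correct`) the relaxed problem has
an optimal potential together with multipliers. The multipliers form a flow, namely a multiple of
the current weights plus a flow in the spanner, whose cost is at most the value of the potential
(`Transshipment.oracleAnswer_flow`). The spanner constraints bound all stretches by a width `ρ`.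
Hence after about `ρ² log n / ε²` iterations the average of the potentials has stretch at most `1 +
ε` on every arc (`mwu_step`, `mwu_final`). Divided by `1 + ε`, this average is a dual solution. Its
value is at least `z / (1 + ε)`, where `z` is the smallest value of an iteration, and the flow of
that iteration costs at most `z`. Weak duality gives all remaining claims.

The spanner is built deterministically: in each round every node announces a lightest incident edge
that some potential feasible for the announced arcs still stretches too much. Clusters occur only in
the analysis (`spanner_rounds`). The picks of a node in logarithmically many consecutive rounds lead
to distinct clusters, so by counting half of the cluster centres hit the picks of all nodes that are
still active. After logarithmically many halvings no cluster is left.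

If `ε n < 1`, then rounding the weights with sufficient accuracy may need more than `O(log n)` bits.
In that case `n` rounds are affordable. They yield a spanner of stretch `1`, and one relaxed problem
with all weights zero is already exact. -/

/-! ### Linear programming duality -/

/-- Farkas' lemma for finitely many linear functionals. -/
theorem farkas_fin {E : Type*} [AddCommGroup E] [Module ℝ E] :
    ∀ (m : ℕ) (a : Fin m → E →ₗ[ℝ] ℝ) (b : E →ₗ[ℝ] ℝ),
      (∀ y, (∀ j, a j y ≤ 0) → b y ≤ 0) →
      ∃ l : Fin m → ℝ, (∀ j, 0 ≤ l j) ∧ ∑ j, l j • a j = b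
  | 0, a, b, h => by
    refine ⟨fun _ => 0, fun _ => le_rfl, ?_⟩
    ext y
    have h1 := h y (fun j => j.elim0)
    have h2 := h (-y) (fun j => j.elim0)
    rw [map_neg] at h2
    simp only [Finset.univ_eq_empty, Finset.sum_empty, LinearMap.zero_apply]
    linarith
  | m + 1, a, b, h => by
    -- Either the last functional is superfluous and gets coefficient `0`, or some `x` shows that it
    -- is needed. In the latter case it is positive at `x` and can be eliminated.
    by_cases hb : ∀ y, (∀ j : Fin m, a j.castSucc y ≤ 0) → b y ≤ 0
    · obtain ⟨l, hl, hs⟩ := farkas_fin m (fun j => a j.castSucc) b hb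
      refine ⟨Fin.snoc l 0, fun j => ?_, ?_⟩
      · refine Fin.lastCases ?_ (fun i => ?_) j
        · simp
        · simpa using hl i
      · rw [Fin.sum_univ_castSucc]
        simpa using hs
    · push Not at hb
      obtain ⟨x, hx, hbx⟩ := hb
      set e := a (Fin.last m) with he
      have hex : 0 < e x := by
        by_contra hc
        refine absurd (h x fun j => ?_) (not_le.mpr hbx)
        refine Fin.lastCases ?_ (fun i => hx i) j
        exact not_lt.mp hc
      -- These are the remaining functionals composed with the projection along `x` onto the kernel
      -- of `e`.
      have key := farkas_fin m (fun j => a j.castSucc - (a j.castSucc x / e x) • e)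
        (b - (b x / e x) • e) (by
          intro y hy
          have h1 := h (y - (e y / e x) • x) (fun j => by
            refine Fin.lastCases ?_ (fun i => ?_) j
            · rw [← he, map_sub, map_smul, smul_eq_mul, div_mul_cancel₀ _ hex.ne']
              simp
            · have := hy i
              simp only [LinearMap.sub_apply, LinearMap.smul_apply, smul_eq_mul] at this
              rw [map_sub, map_smul, smul_eq_mul]
              calc _ = a i.castSucc y - a i.castSucc x / e x * e y := by ring
                _ ≤ 0 := this)
          rw [map_sub, map_smul, smul_eq_mul] at h1
          simp only [LinearMap.sub_apply, LinearMap.smul_apply, smul_eq_mul]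
          calc _ = b y - e y / e x * b x := by ring
            _ ≤ 0 := h1)
      obtain ⟨l, hl, hs⟩ := key
      refine ⟨Fin.snoc l (b x / e x - ∑ j, l j * (a j.castSucc x / e x)), fun j => ?_, ?_⟩
      · refine Fin.lastCases ?_ (fun i => ?_) j
        · simp only [Fin.snoc_last, sub_nonneg]
          refine (Finset.sum_nonpos fun j _ => ?_).trans (div_nonneg hbx.le hex.le)
          exact mul_nonpos_of_nonneg_of_nonpos (hl j) (div_nonpos_of_nonpos_of_nonneg (hx j) hex.le)
        · simpa using hl i
      · rw [Fin.sum_univ_castSucc]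
        simp only [Fin.snoc_castSucc, Fin.snoc_last, ← he]
        ext y
        have h2 := LinearMap.congr_fun hs y
        simp only [LinearMap.add_apply, LinearMap.sub_apply, LinearMap.sum_apply,
          LinearMap.smul_apply, smul_eq_mul, mul_sub, Finset.sum_sub_distrib] at h2 ⊢
        rw [sub_mul, Finset.sum_mul]
        simp only [mul_assoc] at h2 ⊢
        linarith

theorem farkas {E J : Type*} [AddCommGroup E] [Module ℝ E] [Fintype J]
    (a : J → E →ₗ[ℝ] ℝ) (b : E →ₗ[ℝ] ℝ) (h : ∀ y, (∀ j, a j y ≤ 0) → b y ≤ 0) :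
    ∃ l : J → ℝ, (∀ j, 0 ≤ l j) ∧ ∑ j, l j • a j = b := by
  let e := Fintype.equivFin J
  obtain ⟨l, hl, hs⟩ := farkas_fin (Fintype.card J) (fun j => a (e.symm j)) b
    (fun y hy => h y fun j => by simpa using hy (e j))
  refine ⟨fun j => l (e j), fun j => hl _, ?_⟩
  rw [← hs, ← e.sum_comp]
  simp

/-- Farkas' lemma for a system of affine inequalities without solution. -/
theorem farkas_affine {E J : Type*} [AddCommGroup E] [Module ℝ E] [Fintype J]
    (a : J → E →ₗ[ℝ] ℝ) (c : J → ℝ) (h : ¬ ∃ y, ∀ j, a j y ≤ c j) :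
    ∃ l : J → ℝ, (∀ j, 0 ≤ l j) ∧ ∑ j, l j • a j = 0 ∧ ∑ j, l j * c j < 0 := by
  -- Homogenization: a point with `s < 0` in the cone could be rescaled to a solution of the affine
  -- system.
  obtain ⟨l, hl, hs⟩ := farkas (E := E × ℝ)
    (fun j => (a j).comp (LinearMap.fst ℝ E ℝ) + (c j) • LinearMap.snd ℝ E ℝ)
    (-LinearMap.snd ℝ E ℝ) (by
      rintro ⟨y, s⟩ hy
      by_contra hc
      simp only [LinearMap.neg_apply, LinearMap.snd_apply, not_le] at hc
      refine h ⟨(-s)⁻¹ • y, fun j => ?_⟩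
      have := hy j
      simp only [LinearMap.add_apply, LinearMap.comp_apply, LinearMap.fst_apply,
        LinearMap.smul_apply, LinearMap.snd_apply, smul_eq_mul] at this
      rw [map_smul, smul_eq_mul, inv_mul_le_iff₀ hc]
      linarith)
  refine ⟨l, hl, ?_, ?_⟩
  · ext y
    have := LinearMap.congr_fun hs (y, 0)
    simpa using this
  · have := LinearMap.congr_fun hs (0, 1)
    simp at this
    linarith

/-- Strong duality of linear programming, with optimal solutions on both sides. -/
theorem lp_duality {E J : Type*} [AddCommGroup E] [Module ℝ E] [Fintype J]
    (a : J → E →ₗ[ℝ] ℝ) (c : J → ℝ) (b : E →ₗ[ℝ] ℝ) (hp : ∃ y, ∀ j, a j y ≤ c j)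
    (hd : ∃ l : J → ℝ, (∀ j, 0 ≤ l j) ∧ ∑ j, l j • a j = b) :
    ∃ (y : E) (l : J → ℝ), (∀ j, a j y ≤ c j) ∧ (∀ j, 0 ≤ l j) ∧ ∑ j, l j • a j = b ∧
      ∑ j, l j * c j ≤ b y := by
  have weak : ∀ (y : E) (l : J → ℝ), (∀ j, a j y ≤ c j) → (∀ j, 0 ≤ l j) →
      ∑ j, l j • a j = b → b y ≤ ∑ j, l j * c j := by
    intro y l hy hl hs
    rw [← hs]
    simp only [LinearMap.sum_apply, LinearMap.smul_apply, smul_eq_mul]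
    exact Finset.sum_le_sum fun j _ => mul_le_mul_of_nonneg_left (hy j) (hl j)
  let Z : Set ℝ := {z | ∃ l : J → ℝ, (∀ j, 0 ≤ l j) ∧ ∑ j, l j • a j = b ∧ z = ∑ j, l j * c j}
  obtain ⟨y₀, hy₀⟩ := hp
  have hZb : BddBelow Z := ⟨b y₀, by rintro _ ⟨l, hl, hs, rfl⟩; exact weak y₀ l hy₀ hl hs⟩
  obtain ⟨l₀, hl₀, hs₀⟩ := hd
  have hZn : Z.Nonempty := ⟨_, l₀, hl₀, hs₀, rfl⟩
  have h1 : ∃ y, (∀ j, a j y ≤ c j) ∧ sInf Z ≤ b y := by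
    by_contra hc
    -- The index `none` stands for the demand that the value reach `sInf Z`. If its multiplier is
    -- zero, the certificate contradicts `y₀`; otherwise dividing by it gives a dual point of value
    -- below `sInf Z`.
    obtain ⟨u, hu, hus, huc⟩ := farkas_affine (J := Option J)
      (fun j => j.elim (-b) a) (fun j => j.elim (-sInf Z) c) (by
        rintro ⟨y, hy⟩
        refine hc ⟨y, fun j => hy (some j), ?_⟩
        have := hy none
        simp at this
        exact this)
    simp only [Fintype.sum_option, Option.elim] at hus huc
    rcases (hu none).eq_or_lt with h0 | h0
    · have := LinearMap.congr_fun hus y₀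
      simp only [← h0, zero_smul, zero_add, LinearMap.sum_apply, LinearMap.smul_apply,
        smul_eq_mul, LinearMap.zero_apply] at this
      rw [← h0] at huc
      have h2 : ∑ j, u (some j) * a j y₀ ≤ ∑ j, u (some j) * c j :=
        Finset.sum_le_sum fun j _ => mul_le_mul_of_nonneg_left (hy₀ j) (hu _)
      linarith
    · have h2 : sInf Z ≤ ∑ j, (u (some j) / u none) * c j := by
        refine csInf_le hZb ⟨_, fun j => div_nonneg (hu _) h0.le, ?_, rfl⟩
        have h3 : ∑ j, u (some j) • a j = u none • b := by
          rw [smul_neg] at hus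
          rw [← sub_eq_zero, ← hus]
          abel
        simp only [div_eq_inv_mul, mul_smul, ← Finset.smul_sum]
        rw [h3, smul_smul, inv_mul_cancel₀ h0.ne', one_smul]
      have h4 : ∑ j, (u (some j) / u none) * c j = (∑ j, u (some j) * c j) / u none := by
        rw [Finset.sum_div]
        exact Finset.sum_congr rfl fun j _ => by ring
      rw [h4, le_div_iff₀ h0] at h2
      linarith
  obtain ⟨y, hy, hyz⟩ := h1
  -- The dual optimum is attained by Farkas' lemma on the homogenized cone: directions with `s = 0`
  -- are handled by the dual point `l₀`, those with `s < 0` by rescaling and weak duality. The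
  -- multiplier of `s ≤ 0` is slack.
  obtain ⟨l, hl, hs⟩ := farkas (E := E × ℝ) (J := Option J)
    (fun j => j.elim (LinearMap.snd ℝ E ℝ)
      fun j => (a j).comp (LinearMap.fst ℝ E ℝ) + (c j) • LinearMap.snd ℝ E ℝ)
    (b.comp (LinearMap.fst ℝ E ℝ) + (sInf Z) • LinearMap.snd ℝ E ℝ) (by
      rintro ⟨d, s⟩ hds
      have hsn : s ≤ 0 := by simpa using hds none
      have hj : ∀ j, a j d + c j * s ≤ 0 := fun j => by simpa using hds (some j)
      simp only [LinearMap.add_apply, LinearMap.comp_apply, LinearMap.fst_apply,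
        LinearMap.smul_apply, LinearMap.snd_apply, smul_eq_mul]
      rcases hsn.eq_or_lt with rfl | hs0
      · rw [mul_zero, add_zero, ← hs₀]
        simp only [LinearMap.sum_apply, LinearMap.smul_apply, smul_eq_mul]
        exact Finset.sum_nonpos fun j _ =>
          mul_nonpos_of_nonneg_of_nonpos (hl₀ j) (by simpa using hj j)
      · have hs1 : 0 < -s := by linarith
        have : b ((-s)⁻¹ • d) ≤ sInf Z := by
          refine le_csInf hZn ?_
          rintro _ ⟨l, hl, hs, rfl⟩
          refine weak _ l (fun j => ?_) hl hs
          rw [map_smul, smul_eq_mul, inv_mul_le_iff₀ hs1]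
          linarith [hj j]
        rw [map_smul, smul_eq_mul, inv_mul_le_iff₀ hs1] at this
        linarith)
  refine ⟨y, fun j => l (some j), hy, fun j => hl _, ?_, ?_⟩
  · ext x
    have := LinearMap.congr_fun hs (x, 0)
    simpa [Fintype.sum_option] using this
  · have := LinearMap.congr_fun hs (0, 1)
    simp [Fintype.sum_option] at this
    have := hl none
    linarith

/-! ### Hitting sets and the analysis of the spanner construction -/

/-- Few large subsets of `C` can be hit by a subset of `C` of at most half its size. -/
theorem exists_small_hitting_set {ι α : Type*} [DecidableEq α] (A : Finset ι) (N : ι → Finset α)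
    (C : Finset α) (s : ℕ) (hN : ∀ i ∈ A, N i ⊆ C) (hs : ∀ i ∈ A, s ≤ (N i).card)
    (h : 2 * A.card < 2 ^ s) :
    ∃ D ⊆ C, D.card * 2 ≤ C.card ∧ ∀ i ∈ A, ∃ x ∈ D, x ∈ N i := by
  rcases A.eq_empty_or_nonempty with rfl | ⟨i₀, hi₀⟩
  · exact ⟨∅, by simp, by simp, by simp⟩
  have hsC : s ≤ C.card := (hs i₀ hi₀).trans (Finset.card_le_card (hN i₀ hi₀))
  -- The bad subsets are those that miss some `N i` or whose complement in `C` does. There are at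
  -- most `2 * |A| * 2 ^ (|C| - s)` of them, fewer than all subsets. A good subset and its
  -- complement both hit everything, and one of the two has at most half the size.
  let B : Finset (Finset α) := A.biUnion fun i =>
    (C \ N i).powerset ∪ (C \ N i).powerset.image fun D => C \ D
  have hB : B.card < C.powerset.card := by
    have h1 : B.card ≤ A.card * (2 * 2 ^ (C.card - s)) := by
      refine Finset.card_biUnion_le_card_mul _ _ _ fun i hi => ?_
      have h2 : (C \ N i).powerset.card ≤ 2 ^ (C.card - s) := by
        rw [Finset.card_powerset, Finset.card_sdiff_of_subset (hN i hi)]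
        exact Nat.pow_le_pow_right (by norm_num) (Nat.sub_le_sub_left (hs i hi) _)
      have h3 := Finset.card_union_le (C \ N i).powerset
        ((C \ N i).powerset.image fun D => C \ D)
      have h4 : ((C \ N i).powerset.image fun D => C \ D).card ≤ (C \ N i).powerset.card :=
        Finset.card_image_le
      omega
    calc B.card ≤ (2 * A.card) * 2 ^ (C.card - s) := by linarith
      _ < 2 ^ s * 2 ^ (C.card - s) := Nat.mul_lt_mul_of_pos_right h (by positivity)
      _ = C.powerset.card := by rw [← pow_add, Nat.add_sub_cancel' hsC, Finset.card_powerset]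
  obtain ⟨D, hDC, hDB⟩ := Finset.exists_mem_notMem_of_card_lt_card hB
  rw [Finset.mem_powerset] at hDC
  have hit : ∀ i ∈ A, (∃ x ∈ D, x ∈ N i) ∧ ∃ x ∈ C \ D, x ∈ N i := by
    intro i hi
    constructor
    · by_contra hc
      push Not at hc
      refine hDB (Finset.mem_biUnion.mpr ⟨i, hi, Finset.mem_union_left _ ?_⟩)
      rw [Finset.mem_powerset]
      exact fun x hx => Finset.mem_sdiff.mpr ⟨hDC hx, hc x hx⟩
    · by_contra hc
      push Not at hc
      refine hDB (Finset.mem_biUnion.mpr ⟨i, hi, Finset.mem_union_right _ ?_⟩)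
      refine Finset.mem_image.mpr ⟨C \ D, ?_, Finset.sdiff_sdiff_eq_self hDC⟩
      rw [Finset.mem_powerset]
      exact fun x hx => Finset.mem_sdiff.mpr ⟨(Finset.mem_sdiff.mp hx).1, hc x hx⟩
  by_cases hD : D.card * 2 ≤ C.card
  · exact ⟨D, hDC, hD, fun i hi => (hit i hi).1⟩
  · refine ⟨C \ D, Finset.sdiff_subset, ?_, fun i hi => (hit i hi).2⟩
    rw [Finset.card_sdiff_of_subset hDC]
    omega

/-- If in every round each node picks a lightest one of its incident edges that are not yet spanned,
then after `k * s` rounds all edges are spanned. The picks of `s` consecutive rounds lead to distinct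
clusters, so that the number of clusters can be halved every `s` rounds. -/
theorem spanner_rounds {V : Type*} [Fintype V] [DecidableEq V] (w : V → V → ℝ)
    (near : ℕ → V → V → ℝ → Prop) (unsp : ℕ → V → V → Prop) (pick : ℕ → V → V) (k s : ℕ)
    (hs : 2 * Fintype.card V < 2 ^ s) (hk : Fintype.card V < 2 ^ k)
    (w_nonneg : ∀ u v, 0 ≤ w u v) (w_symm : ∀ u v, w u v = w v u)
    (near_refl : ∀ t v, near t v v 0) (near_symm : ∀ t u v a, near t u v a → near t v u a)
    (near_trans : ∀ t u v x a b, near t u v a → near t v x b → near t u x (a + b))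
    (near_mono : ∀ t u v a b, a ≤ b → near t u v a → near t u v b)
    (near_succ : ∀ t u v a, near t u v a → near (t + 1) u v a)
    (unsp_symm : ∀ t u v, unsp t u v → unsp t v u)
    (unsp_succ : ∀ t u v, unsp (t + 1) u v → unsp t u v)
    (unsp_far : ∀ t u v, unsp t u v → ¬ near t u v (2 * k * w u v))
    (pick_unsp : ∀ t v u, unsp t v u → unsp t v (pick t v) ∧ w v (pick t v) ≤ w v u)
    (pick_near : ∀ t v, unsp t v (pick t v) → near (t + 1) v (pick t v) (w v (pick t v))) :
    ∀ u v, ¬ unsp (k * s) u v := by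
  have near_le : ∀ t t' u v a, t ≤ t' → near t u v a → near t' u v a := by
    intro t t' u v a htt h
    induction htt with
    | refl => exact h
    | step _ ih => exact near_succ _ _ _ _ ih
  have unsp_le : ∀ t t' u v, t ≤ t' → unsp t' u v → unsp t u v := by
    intro t t' u v htt
    induction htt with
    | refl => exact id
    | step _ ih => exact fun h => ih (unsp_succ _ _ _ h)
  -- `C` holds the cluster centres after `i * s` rounds. Only nodes with an unspanned edge need a
  -- cluster, and the distance to the centre is measured against each of their unspanned edges.
  have main : ∀ i ≤ k, ∃ (C : Finset V) (c : V → V), C.card * 2 ^ i ≤ Fintype.card V ∧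
      ∀ u v, unsp (i * s) u v → c u ∈ C ∧ near (i * s) u (c u) (i * w u v) := by
    intro i
    induction i with
    | zero =>
      refine fun _ => ⟨Finset.univ, id, by simp, fun u v _ => ⟨by simp, ?_⟩⟩
      simpa using near_refl 0 u
    | succ i ih =>
      intro hik
      obtain ⟨C, c, hC, hc⟩ := ih (by omega)
      have hts : (i + 1) * s = i * s + s := by ring
      let A : Set V := {v | ∃ u, unsp ((i + 1) * s) v u}
      let A' : Finset V := A.toFinite.toFinset
      let p : V → ℕ → V := fun v j => pick (i * s + j) v
      have hp : ∀ v u, unsp ((i + 1) * s) v u → ∀ j < s,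
          unsp (i * s + j) v (p v j) ∧ w v (p v j) ≤ w v u := fun v u h j hj =>
        pick_unsp _ _ _ (unsp_le _ _ _ _ (by omega) h)
      -- If the picks of rounds `j < l` led to the same centre, then the later pick would be within
      -- `(i + 1) * w_j + i * w_l ≤ 2 * k * w_l` of `v`, hence not unspanned. Here `w_j ≤ w_l`,
      -- since the later pick was already available in round `j`.
      have hinj : ∀ v ∈ A, Set.InjOn (fun j => c (p v j)) (Finset.range s : Set ℕ) := by
        have key : ∀ v ∈ A, ∀ j l, j < l → l < s → c (p v j) ≠ c (p v l) := by
          rintro v ⟨u, hu⟩ j l hjl hl heq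
          obtain ⟨h1, -⟩ := hp v u hu j (hjl.trans hl)
          obtain ⟨h2, -⟩ := hp v u hu l hl
          have hw : w v (p v j) ≤ w v (p v l) :=
            (pick_unsp _ _ _ (unsp_le _ _ _ _ (by omega) h2)).2
          have h3 : near (i * s + l) v (p v j) (w v (p v j)) :=
            near_le _ _ _ _ _ (by omega) (pick_near _ _ h1)
          have h4 := (hc _ _ (unsp_le _ (i * s + j) _ _ (by omega) (unsp_symm _ _ _ h1))).2
          have h5 := (hc _ _ (unsp_le _ (i * s + l) _ _ (by omega) (unsp_symm _ _ _ h2))).2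
          rw [heq] at h4
          have h6 := near_trans _ _ _ _ _ _ h3 (near_trans _ _ _ _ _ _
            (near_le _ (i * s + l) _ _ _ (by omega) h4)
            (near_symm _ _ _ _ (near_le _ (i * s + l) _ _ _ (by omega) h5)))
          refine unsp_far _ _ _ h2 (near_mono _ _ _ _ _ ?_ h6)
          rw [w_symm _ v, w_symm _ v]
          have hi : (i : ℝ) + 1 ≤ k := by exact_mod_cast hik
          have h0 := w_nonneg v (p v l)
          have h7 : (i : ℝ) * w v (p v j) ≤ i * w v (p v l) :=
            mul_le_mul_of_nonneg_left hw (Nat.cast_nonneg _)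
          have h8 : ((i : ℝ) + 1) * w v (p v l) ≤ k * w v (p v l) :=
            mul_le_mul_of_nonneg_right hi h0
          linarith
        intro v hv j hj l hl heq
        simp only [Finset.coe_range, Set.mem_Iio] at hj hl
        rcases lt_trichotomy j l with h | h | h
        · exact absurd heq (key v hv j l h hl)
        · exact h
        · exact absurd heq.symm (key v hv l j h hj)
      obtain ⟨D, -, hD, hit⟩ := exists_small_hitting_set A'
        (fun v => (Finset.range s).image fun j => c (p v j)) C s
        (by
          intro v hv x hx
          obtain ⟨u, hu⟩ : v ∈ A := by simpa [A'] using hv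
          obtain ⟨j, hj, rfl⟩ := Finset.mem_image.mp hx
          have h1 := (hp v u hu j (Finset.mem_range.mp hj)).1
          exact (hc _ _ (unsp_le _ (i * s + j) _ _ (by omega) (unsp_symm _ _ _ h1))).1)
        (by
          intro v hv
          rw [Finset.card_image_of_injOn (hinj v (by simpa [A'] using hv)), Finset.card_range])
        (lt_of_le_of_lt (Nat.mul_le_mul_left 2 (Finset.card_le_univ A')) hs)
      have hit' : ∀ v, ∃ x, v ∈ A → x ∈ D ∧ ∃ j < s, c (p v j) = x := by
        intro v
        by_cases hv : v ∈ A
        · obtain ⟨x, hx, hx'⟩ := hit v (by simpa [A'] using hv)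
          obtain ⟨j, hj, hjx⟩ := Finset.mem_image.mp hx'
          exact ⟨x, fun _ => ⟨hx, j, Finset.mem_range.mp hj, hjx⟩⟩
        · exact ⟨v, fun h => absurd h hv⟩
      choose c' hc' using hit'
      -- The new centre is that of a picked neighbour. The pick is no heavier than any edge of `v`
      -- that is still unspanned, so one more edge length suffices.
      refine ⟨D, c', ?_, fun v u hu => ?_⟩
      · calc D.card * 2 ^ (i + 1) = (D.card * 2) * 2 ^ i := by ring
          _ ≤ C.card * 2 ^ i := Nat.mul_le_mul_right _ hD
          _ ≤ _ := hC
      · obtain ⟨hx, j, hj, hjx⟩ := hc' v ⟨u, hu⟩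
        refine ⟨hx, ?_⟩
        obtain ⟨h1, hw⟩ := hp v u hu j hj
        have h4 := (hc _ _ (unsp_le _ (i * s + j) _ _ (by omega) (unsp_symm _ _ _ h1))).2
        rw [hjx, w_symm] at h4
        refine near_mono _ _ _ _ _ ?_ (near_trans _ _ _ _ _ _
          (near_le _ _ _ _ _ (by omega) (pick_near _ _ h1)) (near_le _ _ _ _ _ (by omega) h4))
        push_cast
        have h7 : (i : ℝ) * w v (p v j) ≤ i * w v u :=
          mul_le_mul_of_nonneg_left hw (Nat.cast_nonneg _)
        linarith
  intro u v huv
  obtain ⟨C, c, hC, hc⟩ := main k le_rfl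
  have h1 : 1 ≤ C.card := Finset.card_pos.mpr ⟨_, (hc u v huv).1⟩
  have : 2 ^ k ≤ C.card * 2 ^ k := Nat.le_mul_of_pos_left _ h1
  omega

/-- If every node picks in each round an incident edge that is spanned afterwards, then all edges are
spanned after `n` rounds. -/
theorem exhaust_rounds {V : Type*} [Fintype V] (unsp : ℕ → V → V → Prop) (pick : ℕ → V → V)
    (unsp_succ : ∀ t u v, unsp (t + 1) u v → unsp t u v)
    (pick_unsp : ∀ t v u, unsp t v u → unsp t v (pick t v))
    (pick_succ : ∀ t v, ¬ unsp (t + 1) v (pick t v)) (unsp_ne : ∀ t v, ¬ unsp t v v) :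
    ∀ u v, ¬ unsp (Fintype.card V) u v := by
  classical
  have unsp_le : ∀ t t' u v, t ≤ t' → unsp t' u v → unsp t u v := by
    intro t t' u v htt
    induction htt with
    | refl => exact id
    | step _ ih => exact fun h => ih (unsp_succ _ _ _ h)
  intro v u hu
  -- No edge is picked twice by `v`, so an edge unspanned after `n` rounds would mean `n` distinct
  -- picks among `n - 1` other nodes.
  have hinj : Set.InjOn (fun j => pick j v) (Finset.range (Fintype.card V) : Set ℕ) := by
    have key : ∀ j l, j < l → l < Fintype.card V → pick j v ≠ pick l v := by
      intro j l hjl hl heq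
      have h1 := pick_unsp l v u (unsp_le _ _ _ _ hl.le hu)
      rw [← heq] at h1
      exact pick_succ j v (unsp_le _ _ _ _ hjl h1)
    intro j hj l hl heq
    simp only [Finset.coe_range, Set.mem_Iio] at hj hl
    rcases lt_trichotomy j l with h | h | h
    · exact absurd heq (key j l h hl)
    · exact h
    · exact absurd heq.symm (key l j h hj)
  have h1 : ((Finset.range (Fintype.card V)).image fun j => pick j v) ⊆ Finset.univ.erase v := by
    intro x hx
    obtain ⟨j, hj, rfl⟩ := Finset.mem_image.mp hx
    refine Finset.mem_erase.mpr ⟨fun h => ?_, Finset.mem_univ _⟩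
    have h2 := pick_unsp j v u (unsp_le _ _ _ _ (Finset.mem_range.mp hj).le hu)
    rw [h] at h2
    exact unsp_ne _ _ h2
  have h2 := Finset.card_le_card h1
  rw [Finset.card_image_of_injOn hinj, Finset.card_range,
    Finset.card_erase_of_mem (Finset.mem_univ _), Finset.card_univ] at h2
  have : 0 < Fintype.card V := Fintype.card_pos_iff.mpr ⟨v⟩
  omega

/-! ### Multiplicative weights with rounding -/

/-- One step of the multiplicative weights method with rounded weights `r a * w a / M`: if the
weighted average of the stretches `s a` is at most `1`, then the potential does not grow. -/
theorem mwu_step {A : Type*} [Fintype A] (p s w : A → ℝ) (W ε ρ : ℝ) (M : ℕ)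
    (hp : ∀ a, 0 ≤ p a) (hw : ∀ a, 1 ≤ w a) (hW : ∀ a, w a ≤ W) (hε : 0 < ε) (hε1 : ε ≤ 1)
    (hρ : 1 ≤ ρ) (hs : ∀ a, |s a| ≤ ρ) (hM : 12 * ρ * W ≤ ε * M)
    (hr : ∑ a, (⌊M * p a / w a⌋₊ : ℝ) * w a * s a ≤ ∑ a, (⌊M * p a / w a⌋₊ : ℝ) * w a)
    (hm : ∑ a, p a ≤ Fintype.card A) :
    ∑ a, p a * Real.exp (ε / (36 * ρ ^ 2) * (s a - 1 - ε / 2)) ≤ Fintype.card A := by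
  rcases isEmpty_or_nonempty A with hA | ⟨⟨a₀⟩⟩
  · simp
  have hW1 : 1 ≤ W := (hw a₀).trans (hW a₀)
  have hM0 : (0 : ℝ) < M := by
    by_contra hc
    have h1 : ε * M ≤ 0 := mul_nonpos_of_nonneg_of_nonpos hε.le (not_lt.mp hc)
    have h2 : 0 < 12 * ρ * W := by positivity
    linarith
  -- With this step size the quadratic term of the exponential is at most `η * ε / 4`, half of the
  -- drift `η * ε / 2` caused by the shift. The other half pays for rounding.
  set η := ε / (36 * ρ ^ 2) with hη
  have hη0 : 0 < η := by positivity
  have hηρ : η * (3 * ρ) ^ 2 = ε / 4 := by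
    rw [hη]; field_simp; norm_num
  have hη3 : η * (3 * ρ) ≤ 1 := by
    have : η * (3 * ρ) ≤ η * (3 * ρ) ^ 2 := by
      refine mul_le_mul_of_nonneg_left ?_ hη0.le
      nlinarith
    linarith
  have habs : ∀ a, |s a - 1 - ε / 2| ≤ 3 * ρ := by
    intro a
    have := abs_le.mp (hs a)
    rw [abs_le]
    constructor <;> linarith
  have habs' : ∀ a, |s a - 1| ≤ 3 * ρ := by
    intro a
    have := abs_le.mp (hs a)
    rw [abs_le]
    constructor <;> linarith
  -- growth of a single weight
  have h1 : ∀ a, p a * Real.exp (η * (s a - 1 - ε / 2)) ≤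
      p a + η * (p a * (s a - 1)) - η * ε / 4 * p a := by
    intro a
    have hx : |η * (s a - 1 - ε / 2)| ≤ 1 := by
      rw [abs_mul, abs_of_pos hη0]
      exact (mul_le_mul_of_nonneg_left (habs a) hη0.le).trans hη3
    have h2 := (abs_le.mp (Real.abs_exp_sub_one_sub_id_le hx)).2
    have h3 : (η * (s a - 1 - ε / 2)) ^ 2 ≤ η * (ε / 4) := by
      rw [← hηρ, mul_pow, sq η, mul_assoc]
      refine mul_le_mul_of_nonneg_left ?_ hη0.le
      refine mul_le_mul_of_nonneg_left ?_ hη0.le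
      rw [← sq_abs (s a - 1 - ε / 2)]
      exact pow_le_pow_left₀ (abs_nonneg _) (habs a) 2
    have h4 : Real.exp (η * (s a - 1 - ε / 2)) ≤ 1 + η * (s a - 1) - η * ε / 4 := by linarith
    calc _ ≤ p a * (1 + η * (s a - 1) - η * ε / 4) := mul_le_mul_of_nonneg_left h4 (hp a)
      _ = _ := by ring
  -- the effect of rounding
  have h2 : ∀ a, p a * (s a - 1) ≤
      ((⌊M * p a / w a⌋₊ : ℝ) * w a * s a - (⌊M * p a / w a⌋₊ : ℝ) * w a) / M + ε / 4 := by
    intro a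
    have hwa : 0 < w a := by linarith [hw a]
    set r : ℝ := (⌊M * p a / w a⌋₊ : ℝ) with hr
    have hlo : r * w a ≤ M * p a := by
      have := Nat.floor_le (div_nonneg (mul_nonneg hM0.le (hp a)) hwa.le)
      rwa [le_div_iff₀ hwa] at this
    have hhi : M * p a ≤ r * w a + w a := by
      have := (Nat.lt_floor_add_one (M * p a / w a)).le
      rw [div_le_iff₀ hwa] at this
      linarith
    -- Rounding down loses at most `w a ≤ W`. After division by `M` this is an additive error of at
    -- most `ε / 4` per index, by `hM`.
    have h3 : (M * p a - r * w a) * (s a - 1) ≤ W * (3 * ρ) := by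
      calc _ ≤ |(M * p a - r * w a) * (s a - 1)| := le_abs_self _
        _ = |M * p a - r * w a| * |s a - 1| := abs_mul _ _
        _ ≤ W * (3 * ρ) := by
          refine mul_le_mul ?_ (habs' a) (abs_nonneg _) (by linarith)
          rw [abs_of_nonneg (by linarith)]
          linarith [hW a]
    rw [← sub_le_iff_le_add, le_div_iff₀ hM0]
    have h4 : (p a * (s a - 1) - ε / 4) * M =
        (M * p a - r * w a) * (s a - 1) + (r * w a * s a - r * w a) - ε * M / 4 := by ring
    linarith
  have h3 : ∑ a, p a * (s a - 1) ≤ Fintype.card A * (ε / 4) := by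
    calc _ ≤ ∑ a, (((⌊M * p a / w a⌋₊ : ℝ) * w a * s a - (⌊M * p a / w a⌋₊ : ℝ) * w a) / M
            + ε / 4) := Finset.sum_le_sum fun a _ => h2 a
      _ = (∑ a, (⌊M * p a / w a⌋₊ : ℝ) * w a * s a - ∑ a, (⌊M * p a / w a⌋₊ : ℝ) * w a) / M
            + Fintype.card A * (ε / 4) := by
          rw [Finset.sum_add_distrib, ← Finset.sum_div, Finset.sum_sub_distrib]
          simp
      _ ≤ _ := by
          have := div_nonpos_of_nonpos_of_nonneg (sub_nonpos.mpr hr) hM0.le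
          linarith
  have hηε : η * ε / 4 ≤ 1 := by nlinarith
  -- Additive rounding errors are harmless because the bound is absolute: at total weight `card A`
  -- the decrease and the rounding error balance exactly.
  calc _ ≤ ∑ a, (p a + η * (p a * (s a - 1)) - η * ε / 4 * p a) :=
        Finset.sum_le_sum fun a _ => h1 a
    _ = (1 - η * ε / 4) * ∑ a, p a + η * ∑ a, p a * (s a - 1) := by
        rw [Finset.sum_sub_distrib, Finset.sum_add_distrib, ← Finset.mul_sum, ← Finset.mul_sum]
        ring
    _ ≤ (1 - η * ε / 4) * Fintype.card A + η * (Fintype.card A * (ε / 4)) :=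
        add_le_add (mul_le_mul_of_nonneg_left hm (by linarith))
          (mul_le_mul_of_nonneg_left h3 hη0.le)
    _ = _ := by ring

/-- A bounded potential bounds the total stretch. -/
theorem mwu_final (m S ε ρ : ℝ) (T : ℕ) (hε : 0 < ε) (hρ : 1 ≤ ρ)
    (hm : 0 < m) (hT : 72 * ρ ^ 2 * Real.log m / ε ^ 2 ≤ T)
    (h : Real.exp (ε / (36 * ρ ^ 2) * (S - T * (1 + ε / 2))) ≤ m) :
    S ≤ T * (1 + ε) := by
  have hη : 0 < ε / (36 * ρ ^ 2) := by positivity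
  have h1 := (Real.le_log_iff_exp_le hm).mpr h
  have h2 : Real.log m ≤ ε / (36 * ρ ^ 2) * (T * (ε / 2)) := by
    rw [div_le_iff₀ (by positivity)] at hT
    rw [div_mul_eq_mul_div, le_div_iff₀ (by positivity)]
    nlinarith
  have h3 := le_of_mul_le_mul_left (h1.trans h2) hη
  linarith

/-! ### Encoding of messages, and protocols based on common knowledge -/

/-- A message that consists of four natural numbers. -/
abbrev Message : Type := ℕ × ℕ × ℕ × ℕ

namespace Message

/-- The bit string of a message. -/
def bits (m : Message) : List Bool :=
  (Nat.pair m.1 (Nat.pair m.2.1 (Nat.pair m.2.2.1 m.2.2.2))).bits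

/-- The message with a given bit string. -/
def ofBits (l : List Bool) : Message :=
  let a := Nat.ofDigits 2 (l.map fun b => cond b 1 0)
  let b := a.unpair.2
  (a.unpair.1, b.unpair.1, b.unpair.2.unpair.1, b.unpair.2.unpair.2)

theorem ofBits_bits (m : Message) : ofBits m.bits = m := by
  simp only [ofBits, bits, ← Nat.digits_two_eq_bits, Nat.ofDigits_digits, Nat.unpair_pair]

/-- Each of the three nested pairings squares the bound, which gives `N ^ (8 * D)`. -/
theorem length_bits_le (m : Message) (N D l : ℕ) (hN : N = 2 ^ l) (h1 : m.1 < N ^ D)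
    (h2 : m.2.1 < N ^ D) (h3 : m.2.2.1 < N ^ D) (h4 : m.2.2.2 < N ^ D) :
    m.bits.length ≤ 8 * D * l := by
  have key : ∀ a b X : ℕ, a < X → b < X → Nat.pair a b < X ^ 2 := by
    intro a b X ha hb
    refine (Nat.pair_lt_max_add_one_sq a b).trans_le (Nat.pow_le_pow_left ?_ 2)
    have := max_lt ha hb
    omega
  have hX : 0 < N ^ D := by omega
  have up : ∀ a i, a < N ^ D → i ≠ 0 → a < (N ^ D) ^ i := fun a i ha hi =>
    ha.trans_le (Nat.le_self_pow hi _)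
  have h5 := key _ _ _ h3 h4
  have h6 := key _ _ _ (up _ 2 h2 (by norm_num)) h5
  rw [← pow_mul] at h6
  have h7 := key _ _ _ (up _ (2 * 2) h1 (by norm_num)) h6
  rw [bits, Nat.size_eq_bits_len, Nat.size_le]
  refine h7.trans_le (le_of_eq ?_)
  rw [hN]
  ring

end Message

/-- The function that maps each sender to its message. -/
def board (S : Finset (ℕ × List Bool)) (i : ℕ) : Message :=
  ∑ x ∈ S with x.1 = i, Message.ofBits x.2

/-- An algorithm in which the state of a node consists of its input and of common knowledge of type
`K`, which is updated in each round with the messages of all nodes. -/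
structure Protocol (K : Type) where
  start : K
  message : NodeInput → K → Message
  update : ℝ → K → Finset ℕ → (ℕ → Message) → K
  done : ℝ → K → Prop
  result : NodeInput → K → NodeOutput

namespace Algorithm

variable (alg : Algorithm) {n : ℕ} (I : Transshipment n) (ε : ℝ) (t : ℕ) (v : Fin n)

theorem run_succ : alg.run I ε (t + 1) v =
    if (alg.output (alg.run I ε t v)).isSome then alg.run I ε t v
    else alg.step (alg.run I ε t v) (alg.received I (alg.run I ε t) v) := rfl

theorem run_succ_of_none (h : alg.output (alg.run I ε t v) = none) : alg.run I ε (t + 1) v =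
    alg.step (alg.run I ε t v) (alg.received I (alg.run I ε t) v) := by
  simp [run_succ, h]

theorem run_succ_of_some {o : NodeOutput} (h : alg.output (alg.run I ε t v) = some o) :
    alg.run I ε (t + 1) v = alg.run I ε t v := by
  simp [run_succ, h]

end Algorithm

namespace Protocol

variable {K : Type} (P : Protocol K)

open Classical in
/-- The broadcast congested clique algorithm of a protocol. -/
noncomputable def algorithm : Algorithm where
  State := NodeInput × K
  init i := (i, P.start)
  message s := (P.message s.1 s.2).bits
  step s S :=
    -- A node does not receive its own message. Adding it makes the set the same for all nodes.
    let S' := insert (s.1.ident, (P.message s.1 s.2).bits) S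
    (s.1, P.update s.1.eps s.2 (S'.image Prod.fst) (board S'))
  output s := if P.done s.1.eps s.2 then some (P.result s.1 s.2) else none

variable {n : ℕ} (I : Transshipment n) (ε : ℝ)

/-- The common knowledge after `t` rounds. -/
noncomputable def common : ℕ → K
  | 0 => P.start
  | t + 1 => P.update ε (common t) (Finset.univ.image I.ident)
      (fun i => ∑ v with I.ident v = i, P.message (I.nodeInput ε v) (common t))

/-- All nodes apply the same update to the same messages, and termination depends on common
knowledge and `ε` only, so no node stops before the others. -/
theorem run_eq_common (t : ℕ) (h : ∀ s < t, ¬ P.done ε (P.common I ε s)) (v : Fin n) :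
    P.algorithm.run I ε t v = (I.nodeInput ε v, P.common I ε t) := by
  induction t generalizing v with
  | zero => rfl
  | succ t ih =>
    have ih' := ih fun s hs => h s (hs.trans t.lt_succ_self)
    have hd : ∀ v, P.algorithm.output (P.algorithm.run I ε t v) = none := by
      intro v
      rw [ih' v]
      exact if_neg (h t t.lt_succ_self)
    refine (P.algorithm.run_succ_of_none I ε t v (hd v)).trans ?_
    have hsent : ∀ u, P.algorithm.sent (P.algorithm.run I ε t u) =
        (P.message (I.nodeInput ε u) (P.common I ε t)).bits := by
      intro u
      rw [Algorithm.sent, hd u]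
      simp only [Option.isSome_none, Bool.false_eq_true, if_false]
      rw [ih' u]
      rfl
    have hS : insert (I.ident v, (P.message (I.nodeInput ε v) (P.common I ε t)).bits)
        (P.algorithm.received I (P.algorithm.run I ε t) v) = Finset.univ.image fun u =>
          (I.ident u, (P.message (I.nodeInput ε u) (P.common I ε t)).bits) := by
      ext x
      simp only [Algorithm.received, hsent, Finset.mem_insert, Finset.mem_image,
        Finset.mem_filter, Finset.mem_univ, true_and]
      constructor
      · rintro (rfl | ⟨u, -, rfl⟩)
        exacts [⟨v, rfl⟩, ⟨u, rfl⟩]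
      · rintro ⟨u, rfl⟩
        by_cases huv : u = v
        · exact Or.inl (by rw [huv])
        · exact Or.inr ⟨u, huv, rfl⟩
    generalize P.algorithm.received I (P.algorithm.run I ε t) v = S at hS
    rw [ih' v]
    refine Prod.ext rfl ?_
    change P.update ε (P.common I ε t)
      ((insert (I.ident v, (P.message (I.nodeInput ε v) (P.common I ε t)).bits) S).image Prod.fst)
      (board (insert (I.ident v, (P.message (I.nodeInput ε v) (P.common I ε t)).bits) S)) = _
    rw [common]
    congr 1
    · rw [hS, Finset.image_image]
      rfl
    · rw [hS]
      funext i
      rw [board, Finset.filter_image, Finset.sum_image]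
      · simp only [Message.ofBits_bits]
      · intro a _ b _ hab
        exact I.ident_injective (Prod.ext_iff.mp hab).1

theorem output_run (T : ℕ) (h : ∀ s < T, ¬ P.done ε (P.common I ε s))
    (hT : P.done ε (P.common I ε T)) (v : Fin n) :
    P.algorithm.output (P.algorithm.run I ε T v) =
      some (P.result (I.nodeInput ε v) (P.common I ε T)) := by
  rw [P.run_eq_common I ε T h v]
  exact if_pos hT

/-- From round `T` on the states are frozen and the nodes silent, so only earlier rounds matter. -/
theorem length_sent_le (T : ℕ) (h : ∀ s < T, ¬ P.done ε (P.common I ε s))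
    (hT : P.done ε (P.common I ε T)) (L : ℕ)
    (hL : ∀ t < T, ∀ v, (P.message (I.nodeInput ε v) (P.common I ε t)).bits.length ≤ L)
    (t : ℕ) (v : Fin n) : (P.algorithm.sent (P.algorithm.run I ε t v)).length ≤ L := by
  rcases lt_or_ge t T with ht | ht
  · rw [Algorithm.sent]
    split_ifs
    · simp
    · rw [P.run_eq_common I ε t (fun s hs => h s (hs.trans ht)) v]
      exact hL t ht v
  · have : P.algorithm.run I ε t v = P.algorithm.run I ε T v := by
      induction ht with
      | refl => rfl
      | step _ ih =>
        exact (P.algorithm.run_succ_of_some I ε _ v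
          ((congrArg _ ih).trans (P.output_run I ε T h hT v))).trans ih
    rw [Algorithm.sent, this, P.output_run I ε T h hT v]
    simp

end Protocol

/-! ### Spanner rule, parameters and protocol -/

/-- An arc in terms of identifiers: tail, head and cost. -/
abbrev IdArc : Type := ℕ × ℕ × ℕ

/-- The potentials whose stretch on the arcs in `H` is at most `1`. -/
def Feasible (H : Finset IdArc) (y : ℕ → ℝ) : Prop :=
  ∀ a ∈ H, y a.2.1 - y a.1 ≤ a.2.2

/-- Some potential that is feasible for `H` has stretch more than `β` in one of the directions of
the edge `e` of the node `i`. -/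
def Stretched (β : ℝ) (H : Finset IdArc) (i : ℕ) (e : ℕ × ℕ × ℕ) : Prop :=
  ∃ y, Feasible H y ∧ (β * e.2.1 < y e.1 - y i ∨ β * e.2.2 < y i - y e.1)

/-- The edge `e` of the node `i` is a lightest stretched one. -/
def LightestStretched (β : ℝ) (H : Finset IdArc) (i : ℕ) (edges : Finset (ℕ × ℕ × ℕ))
    (e : ℕ × ℕ × ℕ) : Prop :=
  e ∈ edges ∧ Stretched β H i e ∧
    ∀ e' ∈ edges, Stretched β H i e' → max e.2.1 e.2.2 ≤ max e'.2.1 e'.2.2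

open Classical in
/-- A lightest stretched edge of the node `i`, if there is one. -/
noncomputable def pickEdge (β : ℝ) (H : Finset IdArc) (i : ℕ) (edges : Finset (ℕ × ℕ × ℕ)) :
    ℕ × ℕ × ℕ :=
  if h : ∃ e, LightestStretched β H i edges e then h.choose else (0, 0, 0)

theorem pickEdge_spec {β : ℝ} {H : Finset IdArc} {i : ℕ} {edges : Finset (ℕ × ℕ × ℕ)}
    {e : ℕ × ℕ × ℕ} (he : e ∈ edges) (hs : Stretched β H i e) :
    LightestStretched β H i edges (pickEdge β H i edges) := by
  classical
  have h : ∃ e, LightestStretched β H i edges e := by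
    obtain ⟨x, hx, hmin⟩ := (edges.filter fun e => Stretched β H i e).exists_min_image
      (fun e => max e.2.1 e.2.2) ⟨e, by simp [he, hs]⟩
    simp only [Finset.mem_filter] at hx hmin
    exact ⟨x, hx.1, hx.2, fun e' h1 h2 => hmin e' ⟨h1, h2⟩⟩
  rw [pickEdge, dif_pos h]
  exact h.choose_spec

theorem pickEdge_mem_or (β : ℝ) (H : Finset IdArc) (i : ℕ) (edges : Finset (ℕ × ℕ × ℕ)) :
    pickEdge β H i edges ∈ edges ∨ pickEdge β H i edges = (0, 0, 0) := by
  classical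
  by_cases h : ∃ e, LightestStretched β H i edges e
  · left
    rw [pickEdge, dif_pos h]
    exact h.choose_spec.1
  · right
    rw [pickEdge, dif_neg h]

/-- The arcs that the node `i` announces with a message. -/
def announced (i : ℕ) (e : ℕ × ℕ × ℕ) : Finset IdArc :=
  -- Cost `0` marks the default triple of a node without a stretched edge; genuine costs are at
  -- least `1`.
  if e.2.1 = 0 then ∅ else {(i, e.1, e.2.1), (e.1, i, e.2.2)}

/-! ### The parameters of the algorithm -/

/-- The number of steps of the spanner construction in which the number of clusters is halved. -/
def levels (n : ℕ) : ℕ := Nat.log 2 n + 1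

open Classical in
/-- The stretch of the spanner. -/
noncomputable def stretch (ε : ℝ) (n L : ℕ) : ℝ := if ε * n < 1 then 1 else 2 * levels n * L

/-- A bound on the absolute values of the stretches of potentials that are feasible for the
spanner. -/
noncomputable def width (ε : ℝ) (n L : ℕ) : ℝ := stretch ε n L * L

open Classical in
/-- The number of rounds of the spanner construction. -/
noncomputable def spannerRounds (ε : ℝ) (n : ℕ) : ℕ :=
  if ε * n < 1 then n else levels n * (levels n + 1)

open Classical in
/-- The number of iterations of the multiplicative weights method. -/
noncomputable def iterations (ε : ℝ) (n L : ℕ) : ℕ :=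
  if ε * n < 1 then 1 else ⌈144 * width ε n L ^ 2 * (1 + Real.log n) / ε ^ 2⌉₊ + 1

open Classical in
/-- The factor with which weights are scaled before they are rounded. -/
noncomputable def precision (ε : ℝ) (n L W : ℕ) : ℕ :=
  if ε * n < 1 then 0 else ⌈12 * width ε n L * W / ε⌉₊

/-! ### The protocol -/

/-- A potential, and a combination of the current weights with a flow in the spanner. -/
structure OracleAnswer where
  potential : ℕ → ℝ
  scale : ℝ
  spannerFlow : IdArc → ℝ

/-- The potential `x.potential` and the flow given by `x.scale` and `x.spannerFlow` are optimal
solutions of the dual problem with constraints for the spanner `H` and the additional constraint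
`gᵀy ≤ c`, and of the corresponding primal problem. -/
structure OracleAnswer.Correct (x : OracleAnswer) (ids : Finset ℕ) (b : ℕ → ℤ) (H : Finset IdArc)
    (g : ℕ → ℝ) (c : ℝ) : Prop where
  feasible : Feasible H x.potential
  constraint : ∑ i ∈ ids, g i * x.potential i ≤ c
  scale_nonneg : 0 ≤ x.scale
  flow_nonneg : ∀ a ∈ H, 0 ≤ x.spannerFlow a
  balance : ∀ i ∈ ids, x.scale * g i + (∑ a ∈ H with a.2.1 = i, x.spannerFlow a
    - ∑ a ∈ H with a.1 = i, x.spannerFlow a) = b i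
  optimal : x.scale * c + ∑ a ∈ H, x.spannerFlow a * a.2.2 ≤ ∑ i ∈ ids, b i * x.potential i

instance : Nonempty OracleAnswer := ⟨⟨fun _ => 0, 0, fun _ => 0⟩⟩

/-- A correct answer, if there is one. -/
noncomputable def oracle (ids : Finset ℕ) (b : ℕ → ℤ) (H : Finset IdArc) (g : ℕ → ℝ) (c : ℝ) :
    OracleAnswer :=
  -- The choice depends on common knowledge only, so all nodes make the same one.
  Classical.epsilon fun x => x.Correct ids b H g c

/-- A flow, represented by an oracle answer and the iteration and potential that determined the
weights, and a bound on its cost. -/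
structure FlowRecord where
  value : ℝ
  answer : OracleAnswer
  base : ℕ → ℝ
  time : ℕ

/-- The common knowledge of the nodes. -/
structure Knowledge where
  round : ℕ
  ids : Finset ℕ
  demand : ℕ → ℤ
  ratio : ℕ
  maxWeight : ℕ
  arcs : Finset IdArc
  potential : ℕ → ℝ
  best : FlowRecord

/-- The rounded weight, divided by the cost, of the arc from `u` to `v` with cost `w` in iteration
`t`, if `Y` is the sum of the potentials of the previous iterations. -/
noncomputable def rate (ε : ℝ) (n L W t : ℕ) (Y : ℕ → ℝ) (u v w : ℕ) : ℕ :=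
  -- The weights depend on the past only through the sum of the potentials, so each node can compute
  -- those of its incident arcs.
  ⌊precision ε n L W * Real.exp (ε / (36 * width ε n L ^ 2) *
    ((Y v - Y u) / w - t * (1 + ε / 2))) / w⌋₊

namespace Knowledge

/-- The rounded weights of the current iteration. -/
noncomputable def currentRate (k : Knowledge) (ε : ℝ) : ℕ → ℕ → ℕ → ℕ :=
  rate ε k.ids.card k.ratio k.maxWeight (k.round - 1 - spannerRounds ε k.ids.card) k.potential

open Classical in
/-- The message of a node. -/
noncomputable def message (i : NodeInput) (k : Knowledge) : Message :=
  if k.round = 0 then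
    (i.edges.sup fun e => ⌈(e.2.1 : ℝ) / e.2.2⌉₊, i.edges.sup fun e => e.2.1,
      i.demand.toNat, (-i.demand).toNat)
  else if k.round ≤ spannerRounds i.eps k.ids.card then
    let e := pickEdge (stretch i.eps k.ids.card k.ratio) k.arcs i.ident i.edges
    (e.1, e.2.1, e.2.2, 0)
  else
    (∑ e ∈ i.edges, k.currentRate i.eps e.1 i.ident e.2.2,
      ∑ e ∈ i.edges, k.currentRate i.eps i.ident e.1 e.2.1,
      ∑ e ∈ i.edges, k.currentRate i.eps i.ident e.1 e.2.1 * e.2.1, 0)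

/-- The answer of the oracle to the messages of the nodes. -/
noncomputable def answer (k : Knowledge) (m : ℕ → Message) : OracleAnswer :=
  oracle k.ids k.demand k.arcs (fun i => ((m i).1 : ℝ) - (m i).2.1)
    (∑ i ∈ k.ids, ((m i).2.2.1 : ℝ))

/-- The value of the answer of the oracle. -/
noncomputable def answerValue (k : Knowledge) (m : ℕ → Message) : ℝ :=
  ∑ i ∈ k.ids, k.demand i * (k.answer m).potential i

open Classical in
/-- The common knowledge after the messages of a round. -/
noncomputable def update (ε : ℝ) (k : Knowledge) (ids : Finset ℕ) (m : ℕ → Message) :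
    Knowledge :=
  if k.round = 0 then
    { k with
      round := 1
      ids := ids
      demand := fun i => (m i).2.2.1 - (m i).2.2.2
      ratio := max 1 (ids.sup fun i => (m i).1)
      maxWeight := ids.sup fun i => (m i).2.1 }
  else if k.round ≤ spannerRounds ε k.ids.card then
    { k with
      round := k.round + 1
      arcs := k.arcs ∪ k.ids.biUnion fun i => announced i ((m i).1, (m i).2.1, (m i).2.2.1) }
  else
    { k with
      round := k.round + 1
      potential := fun i => k.potential i + (k.answer m).potential i
      best :=
        -- The first iteration must overwrite the dummy record regardless of its value.
        if k.round = 1 + spannerRounds ε k.ids.card ∨ k.answerValue m < k.best.value then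
          { value := k.answerValue m
            answer := k.answer m
            base := k.potential
            time := k.round - 1 - spannerRounds ε k.ids.card }
        else k.best }

/-- The last iteration has been completed. -/
def Done (ε : ℝ) (k : Knowledge) : Prop :=
  k.round = 1 + spannerRounds ε k.ids.card + iterations ε k.ids.card k.ratio

/-- The output of a node. -/
noncomputable def result (i : NodeInput) (k : Knowledge) : NodeOutput where
  value := k.best.value
  potential j := k.potential j / (iterations i.eps k.ids.card k.ratio * (1 + i.eps))
  flow j :=
    let r := rate i.eps k.ids.card k.ratio k.maxWeight k.best.time k.best.base
    k.best.answer.scale *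
        ∑ e ∈ i.edges with e.1 = j, ((r i.ident j e.2.1 : ℝ) - r j i.ident e.2.2) +
      (∑ a ∈ k.arcs with a.1 = i.ident ∧ a.2.1 = j, k.best.answer.spannerFlow a -
        ∑ a ∈ k.arcs with a.1 = j ∧ a.2.1 = i.ident, k.best.answer.spannerFlow a)

end Knowledge

/-- The protocol that solves the shortest transshipment problem approximately. -/
noncomputable def transshipmentProtocol : Protocol Knowledge where
  start :=
    { round := 0
      ids := ∅
      demand := fun _ => 0
      ratio := 1
      maxWeight := 0
      arcs := ∅
      potential := fun _ => 0
      best := ⟨0, ⟨fun _ => 0, 0, fun _ => 0⟩, fun _ => 0, 0⟩ }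
  message := Knowledge.message
  update := Knowledge.update
  done := Knowledge.Done
  result := Knowledge.result

/-! ### The spanner of an instance -/

namespace Transshipment

variable {n : ℕ} (I : Transshipment n)

theorem mem_edges {ε : ℝ} {v : Fin n} {e : ℕ × ℕ × ℕ} :
    e ∈ (I.nodeInput ε v).edges ↔
      ∃ u, I.graph.Adj v u ∧ (I.ident u, I.weight v u, I.weight u v) = e := by
  simp [nodeInput]

/-- An integral upper bound on the ratio between the costs of the two directions of an edge. -/
noncomputable def ratioBound : ℕ :=
  max 1 (Finset.univ.sup fun v =>
    (I.nodeInput 0 v).edges.sup fun e => ⌈(e.2.1 : ℝ) / e.2.2⌉₊)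

/-- The maximum cost of an arc. -/
noncomputable def weightBound : ℕ :=
  Finset.univ.sup fun v => (I.nodeInput 0 v).edges.sup fun e => e.2.1

theorem weight_le_weightBound {u v : Fin n} (h : I.graph.Adj u v) :
    I.weight u v ≤ I.weightBound := by
  have h1 : (I.ident v, I.weight u v, I.weight v u) ∈ (I.nodeInput 0 u).edges :=
    I.mem_edges.mpr ⟨v, h, rfl⟩
  exact (Finset.le_sup (f := fun e : ℕ × ℕ × ℕ => e.2.1) h1).trans
    (Finset.le_sup (f := fun v => (I.nodeInput 0 v).edges.sup fun e => e.2.1) (Finset.mem_univ u))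

theorem weightBound_le {B : ℕ} (hB : ∀ u v, I.graph.Adj u v → I.weight u v ≤ B) :
    I.weightBound ≤ B := by
  refine Finset.sup_le fun v _ => Finset.sup_le fun e he => ?_
  obtain ⟨u, hu, rfl⟩ := I.mem_edges.mp he
  exact hB v u hu

theorem one_le_ratioBound : 1 ≤ I.ratioBound := le_max_left _ _

theorem ratioBound_le {B : ℕ} (h1 : 1 ≤ B)
    (hB : ∀ u v, I.graph.Adj u v → ⌈(I.weight u v : ℝ) / I.weight v u⌉₊ ≤ B) :
    I.ratioBound ≤ B := by
  refine max_le h1 (Finset.sup_le fun v _ => Finset.sup_le fun e he => ?_)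
  obtain ⟨u, hu, rfl⟩ := I.mem_edges.mp he
  exact hB v u hu

theorem weight_le_ratioBound_mul {u v : Fin n} (h : I.graph.Adj u v) :
    (I.weight u v : ℝ) ≤ I.ratioBound * I.weight v u := by
  have h1 : (I.ident v, I.weight u v, I.weight v u) ∈ (I.nodeInput 0 u).edges :=
    I.mem_edges.mpr ⟨v, h, rfl⟩
  have h2 : ⌈(I.weight u v : ℝ) / I.weight v u⌉₊ ≤ I.ratioBound :=
    ((Finset.le_sup (f := fun e : ℕ × ℕ × ℕ => ⌈(e.2.1 : ℝ) / e.2.2⌉₊) h1).trans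
      (Finset.le_sup (f := fun v => (I.nodeInput 0 v).edges.sup
        fun e => ⌈(e.2.1 : ℝ) / e.2.2⌉₊) (Finset.mem_univ u))).trans (le_max_right _ _)
  have h3 : (0 : ℝ) < I.weight v u := by exact_mod_cast I.weight_pos v u h.symm
  rw [← div_le_iff₀ h3]
  exact Nat.ceil_le.mp h2

theorem one_le_lam : 1 ≤ I.lam := le_max_left _ _

/-- Ratios are rounded up to be sent as integers. As `lam` is at least `1`, this costs at most a
factor `2`. -/
theorem ratioBound_le_lam : (I.ratioBound : ℝ) ≤ 2 * I.lam := by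
  have h1 : ∀ u v, I.graph.Adj u v → (I.weight u v : ℝ) / I.weight v u ≤ I.lam := by
    intro u v h
    have h2 : I.arcCost ⟨(u, v), h⟩ / I.arcCost (SimpleGraph.Dart.symm ⟨(u, v), h⟩) ≤ I.lam := by
      classical
      exact (le_ciSup (f := fun a : I.graph.Dart => I.arcCost a / I.arcCost a.symm)
        (Set.finite_range _).bddAbove ⟨(u, v), h⟩).trans (le_max_right _ _)
    exact h2
  have h3 : I.ratioBound ≤ ⌈I.lam⌉₊ := by
    refine I.ratioBound_le ?_ fun u v h => Nat.ceil_le_ceil (h1 u v h)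
    exact Nat.one_le_ceil_iff.mpr (by linarith [I.one_le_lam])
  have h4 : (⌈I.lam⌉₊ : ℝ) < I.lam + 1 := Nat.ceil_lt_add_one (by linarith [I.one_le_lam])
  have h5 : (I.ratioBound : ℝ) ≤ ⌈I.lam⌉₊ := by exact_mod_cast h3
  linarith [I.one_le_lam]

variable (ε : ℝ)

/-- The stretch of the spanner that is constructed. -/
noncomputable def spannerStretch : ℝ := stretch ε n I.ratioBound

/-- The arcs of the spanner after `t` rounds of its construction. -/
noncomputable def spanner : ℕ → Finset IdArc
  | 0 => ∅
  | t + 1 => spanner t ∪ Finset.univ.biUnion fun v => announced (I.ident v)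
      (pickEdge (I.spannerStretch ε) (spanner t) (I.ident v) (I.nodeInput ε v).edges)

theorem spanner_sound (t : ℕ) {a : IdArc} (ha : a ∈ I.spanner ε t) :
    ∃ u v, I.graph.Adj u v ∧ a = (I.ident u, I.ident v, I.weight u v) := by
  induction t with
  | zero => simp [spanner] at ha
  | succ t ih =>
    rw [spanner, Finset.mem_union] at ha
    rcases ha with ha | ha
    · exact ih ha
    · obtain ⟨v, -, hv⟩ := Finset.mem_biUnion.mp ha
      rcases pickEdge_mem_or (I.spannerStretch ε) (I.spanner ε t) (I.ident v)
        (I.nodeInput ε v).edges with h | h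
      · obtain ⟨u, hu, he⟩ := I.mem_edges.mp h
        rw [← he, announced] at hv
        split_ifs at hv
        · simp at hv
        · simp only [Finset.mem_insert, Finset.mem_singleton] at hv
          rcases hv with rfl | rfl
          · exact ⟨v, u, hu, rfl⟩
          · exact ⟨u, v, hu.symm, rfl⟩
      · rw [h] at hv
        simp [announced] at hv

theorem one_le_spannerStretch : 1 ≤ I.spannerStretch ε := by
  rw [spannerStretch, stretch]
  split_ifs
  · exact le_rfl
  · have h1 : (1 : ℝ) ≤ I.ratioBound := by exact_mod_cast I.one_le_ratioBound
    have h2 : (1 : ℝ) ≤ levels n := by simp [levels]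
    nlinarith

/-- The edge between `u` and `v` is stretched in round `t` of the spanner construction. -/
def StretchedAt (t : ℕ) (u v : Fin n) : Prop :=
  I.graph.Adj u v ∧ Stretched (I.spannerStretch ε) (I.spanner ε t) (I.ident u)
    (I.ident v, I.weight u v, I.weight v u)

open Classical in
/-- The node to which the edge picked by `v` in round `t` leads. -/
noncomputable def pick (t : ℕ) (v : Fin n) : Fin n :=
  if h : ∃ u, I.graph.Adj v u ∧ (I.ident u, I.weight v u, I.weight u v) =
      pickEdge (I.spannerStretch ε) (I.spanner ε t) (I.ident v) (I.nodeInput ε v).edges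
  then h.choose else v

theorem pick_spec {t : ℕ} {v u : Fin n} (h : I.StretchedAt ε t v u) :
    I.StretchedAt ε t v (I.pick ε t v) ∧
      max (I.weight v (I.pick ε t v)) (I.weight (I.pick ε t v) v) ≤
        max (I.weight v u) (I.weight u v) ∧
      (I.ident v, I.ident (I.pick ε t v), I.weight v (I.pick ε t v)) ∈ I.spanner ε (t + 1) ∧
      (I.ident (I.pick ε t v), I.ident v, I.weight (I.pick ε t v) v) ∈ I.spanner ε (t + 1) := by
  obtain ⟨h1, h2, h3⟩ := pickEdge_spec (I.mem_edges.mpr ⟨u, h.1, rfl⟩ :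
    _ ∈ (I.nodeInput ε v).edges) h.2
  have h4 := I.mem_edges.mp h1
  have h5 : I.graph.Adj v (I.pick ε t v) ∧ (I.ident (I.pick ε t v),
      I.weight v (I.pick ε t v), I.weight (I.pick ε t v) v) =
      pickEdge (I.spannerStretch ε) (I.spanner ε t) (I.ident v) (I.nodeInput ε v).edges := by
    rw [pick, dif_pos h4]
    exact h4.choose_spec
  obtain ⟨h5, h6⟩ := h5
  rw [← h6] at h2 h3
  have h7 : ∀ a ∈ announced (I.ident v) (I.ident (I.pick ε t v),
      I.weight v (I.pick ε t v), I.weight (I.pick ε t v) v), a ∈ I.spanner ε (t + 1) := by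
    intro a ha
    rw [spanner]
    refine Finset.mem_union_right _ (Finset.mem_biUnion.mpr ⟨v, Finset.mem_univ _, ?_⟩)
    rwa [← h6]
  have h8 : I.weight v (I.pick ε t v) ≠ 0 := Nat.one_le_iff_ne_zero.mp (I.weight_pos _ _ h5)
  refine ⟨⟨h5, h2⟩, h3 _ (I.mem_edges.mpr ⟨u, h.1, rfl⟩) h.2, h7 _ ?_, h7 _ ?_⟩ <;>
    simp [announced, h8]

theorem feasible_of_succ {t : ℕ} {y : ℕ → ℝ} (h : Feasible (I.spanner ε (t + 1)) y) :
    Feasible (I.spanner ε t) y := fun a ha => h a (by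
  rw [spanner]
  exact Finset.mem_union_left _ ha)

theorem stretchedAt_of_succ {t : ℕ} {u v : Fin n} (h : I.StretchedAt ε (t + 1) u v) :
    I.StretchedAt ε t u v := by
  obtain ⟨h1, y, hy, h2⟩ := h
  exact ⟨h1, y, I.feasible_of_succ ε hy, h2⟩

theorem StretchedAt.symm {I : Transshipment n} {ε : ℝ} {t : ℕ} {u v : Fin n}
    (h : I.StretchedAt ε t u v) : I.StretchedAt ε t v u := by
  obtain ⟨h1, y, hy, h2⟩ := h
  exact ⟨h1.symm, y, hy, h2.symm⟩

/-- For `ε * n < 1` the stretch is `1`, and an announced edge cannot be stretched again, so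
`exhaust_rounds` applies. Otherwise the cluster argument does. -/
theorem not_stretchedAt_end (u v : Fin n) : ¬ I.StretchedAt ε (spannerRounds ε n) u v := by
  classical
  by_cases hsmall : ε * n < 1
  · have hβ : I.spannerStretch ε = 1 := by rw [spannerStretch, stretch, if_pos hsmall]
    rw [spannerRounds, if_pos hsmall]
    have := exhaust_rounds (V := Fin n) (fun t u v => I.StretchedAt ε t u v) (I.pick ε)
      (fun t u v => I.stretchedAt_of_succ ε) (fun t v u h => (I.pick_spec ε h).1)
      (by
        intro t v h
        obtain ⟨-, -, h1, h2⟩ := I.pick_spec ε (I.stretchedAt_of_succ ε h)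
        obtain ⟨-, y, hy, h3⟩ := h
        rw [hβ] at h3
        have h4 := hy _ h1
        have h5 := hy _ h2
        simp only [one_mul] at h3 h4 h5
        rcases h3 with h3 | h3 <;> linarith)
      (fun t v h => h.1.ne rfl)
    simpa using this u v
  · have hβ : I.spannerStretch ε = 2 * levels n * I.ratioBound := by
      rw [spannerStretch, stretch, if_neg hsmall]
    rw [spannerRounds, if_neg hsmall]
    have hn : Fintype.card (Fin n) < 2 ^ levels n := by
      rw [Fintype.card_fin]
      exact Nat.lt_pow_succ_log_self (by norm_num) n
    -- The length of an edge is the larger of its two costs. Distance is expressed by potentials: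
    -- nodes are near if no feasible potential separates them by more than `a`. Passing from the
    -- larger cost to either cost loses the factor `ratioBound` in the stretch.
    refine spanner_rounds (V := Fin n) (fun u v => max (I.weight u v : ℝ) (I.weight v u))
      (fun t u v a => ∀ y, Feasible (I.spanner ε t) y → |y (I.ident u) - y (I.ident v)| ≤ a)
      (fun t u v => I.StretchedAt ε t u v) (I.pick ε) (levels n) (levels n + 1)
      (by rw [pow_succ]; omega) hn (fun u v => by positivity) (fun u v => max_comm _ _)
      (fun t v y _ => by simp) (fun t u v a h y hy => by rw [abs_sub_comm]; exact h y hy)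
      (fun t u v x a b h1 h2 y hy => (abs_sub_le _ _ _).trans (add_le_add (h1 y hy) (h2 y hy)))
      (fun t u v a b hab h y hy => (h y hy).trans hab)
      (fun t u v a h y hy => h y (I.feasible_of_succ ε hy))
      (fun t u v h => h.symm) (fun t u v => I.stretchedAt_of_succ ε) ?_ ?_ ?_ u v
    · rintro t u v ⟨hadj, y, hy, h1⟩ h2
      have h3 := abs_le.mp (h2 y hy)
      have h4 := I.weight_le_ratioBound_mul hadj
      have h5 := I.weight_le_ratioBound_mul hadj.symm
      have h6 : (1 : ℝ) ≤ I.ratioBound := by exact_mod_cast I.one_le_ratioBound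
      have h7 : (I.weight u v : ℝ) ≤ I.ratioBound * I.weight u v :=
        le_mul_of_one_le_left (Nat.cast_nonneg _) h6
      have h8 : (I.weight v u : ℝ) ≤ I.ratioBound * I.weight v u :=
        le_mul_of_one_le_left (Nat.cast_nonneg _) h6
      have h9 : (0 : ℝ) ≤ 2 * levels n := by positivity
      have h10 := mul_le_mul_of_nonneg_left (max_le h7 h5) h9
      have h11 := mul_le_mul_of_nonneg_left (max_le h4 h8) h9
      rw [hβ] at h1
      simp only at h1
      rcases h1 with h1 | h1 <;> linarith
    · intro t v u h
      obtain ⟨h1, h2, -⟩ := I.pick_spec ε h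
      exact ⟨h1, by exact_mod_cast h2⟩
    · intro t v h y hy
      obtain ⟨-, -, h1, h2⟩ := I.pick_spec ε h
      have h4 := hy _ h1
      have h5 := hy _ h2
      simp only at h4 h5
      rw [abs_le]
      have h6 := le_max_left (I.weight v (I.pick ε t v) : ℝ) (I.weight (I.pick ε t v) v)
      have h7 := le_max_right (I.weight v (I.pick ε t v) : ℝ) (I.weight (I.pick ε t v) v)
      constructor <;> linarith

/-- The arcs of the spanner. -/
noncomputable def spannerArcs : Finset IdArc := I.spanner ε (spannerRounds ε n)

theorem stretch_le {y : ℕ → ℝ} (hy : Feasible (I.spannerArcs ε) y) {u v : Fin n}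
    (h : I.graph.Adj u v) :
    y (I.ident v) - y (I.ident u) ≤ I.spannerStretch ε * I.weight u v := by
  by_contra hc
  exact I.not_stretchedAt_end ε u v ⟨h, y, hy, Or.inl (not_le.mp hc)⟩

end Transshipment

/-! ### Solvability of the relaxed problem -/

namespace Transshipment

variable {n : ℕ} (I : Transshipment n) (ε : ℝ)

/-- The identifiers of all nodes. -/
def ids : Finset ℕ := Finset.univ.image I.ident

theorem sum_ids {M : Type*} [AddCommMonoid M] (f : ℕ → M) :
    ∑ i ∈ I.ids, f i = ∑ v, f (I.ident v) :=
  Finset.sum_image fun _ _ _ _ h => I.ident_injective h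

theorem card_ids : I.ids.card = n := by
  rw [ids, Finset.card_image_of_injective _ I.ident_injective, Finset.card_univ, Fintype.card_fin]

theorem eq_of_adj_le {d : Fin n → ℝ} (h : ∀ u v, I.graph.Adj u v → d v ≤ d u) (u v : Fin n) :
    d u = d v := by
  obtain ⟨p⟩ := I.connected.preconnected u v
  induction p with
  | nil => rfl
  | cons hadj _ ih => exact (le_antisymm (h _ _ hadj.symm) (h _ _ hadj)).trans ih

/-- The zero potential is feasible as `c` is nonnegative. The multipliers exist because a direction
that increases along no spanner arc is constant on the nodes, so its value is zero for demands of
sum zero. -/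
theorem exists_correct (b : ℕ → ℤ) (hb : ∀ v, b (I.ident v) = I.demand v) (g : ℕ → ℝ) (c : ℝ)
    (hc : 0 ≤ c) : ∃ x : OracleAnswer, x.Correct I.ids b (I.spannerArcs ε) g c := by
  classical
  let coord : ℕ → (ℕ → ℝ) →ₗ[ℝ] ℝ := fun i => LinearMap.proj i
  have coord_apply : ∀ i d, coord i d = d i := fun _ _ => rfl
  let F : Option (I.spannerArcs ε) → (ℕ → ℝ) →ₗ[ℝ] ℝ := fun j => j.elim
    (∑ i ∈ I.ids, g i • coord i)
    fun a => coord a.1.2.1 - coord a.1.1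
  let r : Option (I.spannerArcs ε) → ℝ := fun j => j.elim c fun a => (a.1.2.2 : ℝ)
  let B : (ℕ → ℝ) →ₗ[ℝ] ℝ := ∑ i ∈ I.ids, (b i : ℝ) • coord i
  have hBsum : ∑ i ∈ I.ids, (b i : ℝ) = 0 := by
    rw [I.sum_ids fun i => (b i : ℝ)]
    simp only [hb]
    exact_mod_cast I.demand_sum
  have hp : ∃ y, ∀ j, F j y ≤ r j := by
    refine ⟨0, fun j => ?_⟩
    rw [map_zero]
    cases j with
    | none => exact hc
    | some a => exact Nat.cast_nonneg _
  have hd : ∃ l : Option (I.spannerArcs ε) → ℝ, (∀ j, 0 ≤ l j) ∧ ∑ j, l j • F j = B := by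
    refine farkas F B fun d hd => ?_
    have h1 : ∀ u v, I.graph.Adj u v → d (I.ident v) ≤ d (I.ident u) := by
      intro u v huv
      by_contra hlt
      rw [not_le] at hlt
      -- Every multiple of `d` is feasible for the spanner, so a positive increase along an edge
      -- would eventually violate the stretch bound.
      obtain ⟨K, hK⟩ := exists_nat_gt
        (I.spannerStretch ε * I.weight u v / (d (I.ident v) - d (I.ident u)))
      rw [div_lt_iff₀ (sub_pos.mpr hlt)] at hK
      have h2 : Feasible (I.spannerArcs ε) fun i => K * d i := by
        intro a ha
        have h3 := hd (some ⟨a, ha⟩)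
        simp only [F, Option.elim, LinearMap.sub_apply, coord_apply] at h3
        have h4 := mul_nonpos_of_nonneg_of_nonpos (Nat.cast_nonneg (α := ℝ) K) h3
        have h5 : (0 : ℝ) ≤ a.2.2 := Nat.cast_nonneg _
        simp only
        linarith
      have h3 := I.stretch_le ε h2 huv
      linarith
    obtain ⟨v₀⟩ := I.connected.nonempty
    have h2 : B d = 0 := by
      simp only [B, LinearMap.sum_apply, LinearMap.smul_apply, coord_apply, smul_eq_mul]
      have h3 : ∀ i ∈ I.ids, (b i : ℝ) * d i = b i * d (I.ident v₀) := by
        intro i hi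
        obtain ⟨v, -, rfl⟩ := Finset.mem_image.mp hi
        rw [I.eq_of_adj_le (d := fun v => d (I.ident v)) h1 v v₀]
      rw [Finset.sum_congr rfl h3, ← Finset.sum_mul, hBsum, zero_mul]
    exact h2.le
  obtain ⟨y, l, hy, hl, hs, hopt⟩ := lp_duality F r B hp hd
  let h : IdArc → ℝ := fun a => if ha : a ∈ I.spannerArcs ε then l (some ⟨a, ha⟩) else 0
  have hsum : ∀ f : IdArc → ℝ,
      ∑ a ∈ I.spannerArcs ε, h a * f a = ∑ a : I.spannerArcs ε, l (some a) * f a := by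
    intro f
    rw [← Finset.sum_coe_sort]
    refine Finset.sum_congr rfl fun a _ => ?_
    simp [h]
  refine ⟨⟨y, l none, h⟩, ⟨?_, ?_, hl none, ?_, ?_, ?_⟩⟩
  · intro a ha
    exact hy (some ⟨a, ha⟩)
  · have := hy none
    simpa [F, r, coord_apply] using this
  · intro a ha
    simp only [h, dif_pos ha]
    exact hl _
  · intro i hi
    -- The identity of functionals, evaluated at a unit vector, is flow conservation at `i`.
    have h1 := LinearMap.congr_fun hs (Pi.single i 1)
    simp only [F, B, Fintype.sum_option, Option.elim, LinearMap.add_apply, LinearMap.sum_apply,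
      LinearMap.smul_apply, LinearMap.sub_apply, coord_apply, smul_eq_mul] at h1
    simp only [Pi.single_apply, mul_ite, mul_one, mul_zero, Finset.sum_ite_eq', hi, if_true] at h1
    rw [← h1]
    congr 1
    rw [Finset.sum_filter, Finset.sum_filter, ← Finset.sum_sub_distrib]
    refine Eq.trans ?_ (hsum fun a => (if a.2.1 = i then 1 else 0) - if a.1 = i then 1 else 0)
    refine Finset.sum_congr rfl fun a _ => ?_
    simp only [mul_sub, mul_ite, mul_one, mul_zero]
  · simp only [Fintype.sum_option] at hopt
    simp only [r, B, Option.elim, LinearMap.sum_apply, LinearMap.smul_apply,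
      coord_apply, smul_eq_mul] at hopt
    simp only
    rw [hsum fun a => (a.2.2 : ℝ)]
    exact hopt

end Transshipment

/-! ### Weak duality, and flows from oracle answers -/

namespace Transshipment

variable {n : ℕ} (I : Transshipment n)

theorem arcCost_pos (a : I.graph.Dart) : 1 ≤ I.arcCost a := by
  rw [arcCost]
  exact_mod_cast I.weight_pos _ _ a.adj

theorem isPotential_iff (y : Fin n → ℝ) :
    I.IsPotential y ↔ ∀ a : I.graph.Dart, y a.snd - y a.fst ≤ I.arcCost a := by
  classical
  rw [IsPotential, qNorm]
  have h1 : ∀ a : I.graph.Dart,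
      (y a.snd - y a.fst) / I.arcCost a ≤ 1 ↔ y a.snd - y a.fst ≤ I.arcCost a := fun a =>
    div_le_one (by linarith [I.arcCost_pos a])
  constructor
  · intro h a
    rw [← h1]
    exact (le_ciSup (f := fun a : I.graph.Dart => (y a.snd - y a.fst) / I.arcCost a)
      (Set.finite_range _).bddAbove a).trans ((le_max_right _ _).trans h)
  · intro h
    exact max_le zero_le_one (Real.iSup_le (fun a => (h1 a).mpr (h a)) zero_le_one)

open Classical in
theorem sum_darts_symm (f : I.graph.Dart → ℝ) :
    ∑ a : I.graph.Dart, f a.symm = ∑ a : I.graph.Dart, f a :=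
  Fintype.sum_bijective _ SimpleGraph.Dart.symm_involutive.bijective _ _ fun _ => rfl

open Classical in
theorem sum_darts_snd (f : I.graph.Dart → ℝ) (y : Fin n → ℝ) :
    ∑ v, (∑ a : I.graph.Dart with a.snd = v, f a) * y v =
      ∑ a : I.graph.Dart, f a * y a.snd := by
  rw [← Finset.sum_fiberwise Finset.univ (fun a : I.graph.Dart => a.snd)]
  refine Finset.sum_congr rfl fun v _ => ?_
  rw [Finset.sum_mul]
  refine Finset.sum_congr rfl fun a ha => ?_
  rw [(Finset.mem_filter.mp ha).2]

open Classical in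
theorem sum_darts_fst (f : I.graph.Dart → ℝ) (y : Fin n → ℝ) :
    ∑ v, (∑ a : I.graph.Dart with a.fst = v, f a) * y v =
      ∑ a : I.graph.Dart, f a * y a.fst := by
  rw [← Finset.sum_fiberwise Finset.univ (fun a : I.graph.Dart => a.fst)]
  refine Finset.sum_congr rfl fun v _ => ?_
  rw [Finset.sum_mul]
  refine Finset.sum_congr rfl fun a ha => ?_
  rw [(Finset.mem_filter.mp ha).2]

open Classical in
-- Each edge occurs as two darts, so by antisymmetry the sum of `x a * (y a.snd - y a.fst)` is twice
-- the dual value, and it is at most twice the cost.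
theorem weak_duality {x : I.graph.Dart → ℝ} {y : Fin n → ℝ} (hx : I.IsFlow x)
    (hy : I.IsPotential y) : I.dualValue y ≤ I.cost x := by
  rw [isPotential_iff] at hy
  have h1 : I.dualValue y = ∑ a : I.graph.Dart, x a * y a.snd := by
    rw [dualValue, ← I.sum_darts_snd]
    exact Finset.sum_congr rfl fun v _ => by rw [hx.2 v]
  have h2 : ∑ a : I.graph.Dart, x a * y a.snd = - ∑ a : I.graph.Dart, x a * y a.fst := by
    rw [← I.sum_darts_symm, ← Finset.sum_neg_distrib]
    exact Finset.sum_congr rfl fun a _ => by rw [hx.1 a, neg_mul]; rfl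
  have h3 : ∀ a : I.graph.Dart, x a * (y a.snd - y a.fst) ≤
      max 0 (I.arcCost a * x a) + max 0 (I.arcCost a.symm * x a.symm) := by
    intro a
    rcases le_total 0 (x a) with h | h
    · have h4 := mul_le_mul_of_nonneg_left (hy a) h
      have h5 := le_max_right 0 (I.arcCost a * x a)
      have h6 := le_max_left 0 (I.arcCost a.symm * x a.symm)
      linarith
    · have h4 := mul_le_mul_of_nonneg_left (hy a.symm) (neg_nonneg.mpr h)
      have h5 := le_max_left 0 (I.arcCost a * x a)
      have h6 := le_max_right 0 (I.arcCost a.symm * x a.symm)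
      rw [hx.1 a] at h6 ⊢
      have h7 : y a.symm.snd - y a.symm.fst = y a.fst - y a.snd := rfl
      rw [h7] at h4
      linarith
  have h4 := Finset.sum_le_sum fun a (_ : a ∈ (Finset.univ : Finset I.graph.Dart)) => h3 a
  rw [Finset.sum_add_distrib, I.sum_darts_symm fun a => max 0 (I.arcCost a * x a)] at h4
  simp only [mul_sub, Finset.sum_sub_distrib] at h4
  have h5 : I.cost x = ∑ a : I.graph.Dart, max 0 (I.arcCost a * x a) := rfl
  linarith

/-- One number `z` between the cost of `x` and `1 + ε` times the value of `y` certifies all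
guarantees through weak duality. -/
theorem isApproxSolution_of {ε : ℝ} (hε : 0 < ε) {out : Fin n → NodeOutput}
    {x : I.graph.Dart → ℝ} {y : Fin n → ℝ} {z : ℝ}
    (hflow : ∀ a : I.graph.Dart, (out a.fst).flow (I.ident a.snd) = x a)
    (hpot : ∀ v u, (out v).potential (I.ident u) = y u) (hval : ∀ v, (out v).value = z)
    (hx : I.IsFlow x) (hy : I.IsPotential y) (hxz : I.cost x ≤ z)
    (hzy : z ≤ (1 + ε) * I.dualValue y) : I.IsApproxSolution ε out := by
  have h1 : ∀ x', I.IsFlow x' → z ≤ (1 + ε) * I.cost x' := fun x' hx' =>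
    hzy.trans (mul_le_mul_of_nonneg_left (I.weak_duality hx' hy) (by linarith))
  refine ⟨x, y, hflow, hpot, hx, hy, hxz.trans hzy, fun x' hx' => hxz.trans (h1 x' hx'),
    fun y' hy' => (I.weak_duality hx hy').trans (hxz.trans hzy), fun v => ?_⟩
  rw [hval v]
  have hb : BddBelow (I.cost '' {x | I.IsFlow x}) := by
    refine ⟨I.dualValue y, ?_⟩
    rintro _ ⟨x', hx', rfl⟩
    exact I.weak_duality hx' hy
  constructor
  · exact (csInf_le hb ⟨x, hx, rfl⟩).trans hxz
  · rw [← div_le_iff₀' (by linarith)]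
    refine le_csInf ⟨_, x, hx, rfl⟩ ?_
    rintro _ ⟨x', hx', rfl⟩
    rw [div_le_iff₀' (by linarith)]
    exact h1 x' hx'

/-- An arc in terms of identifiers. -/
def idArc (a : I.graph.Dart) : IdArc := (I.ident a.fst, I.ident a.snd, I.weight a.fst a.snd)

theorem idArc_injective : Function.Injective I.idArc := by
  intro a b h
  simp only [idArc, Prod.mk.injEq] at h
  exact SimpleGraph.Dart.ext _ _ (Prod.ext (I.ident_injective h.1) (I.ident_injective h.2.1))

open Classical in
theorem sum_edges_out {M : Type*} [AddCommMonoid M] (ε : ℝ) (v : Fin n) (f : IdArc → M) :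
    ∑ e ∈ (I.nodeInput ε v).edges, f (I.ident v, e.1, e.2.1) =
      ∑ a : I.graph.Dart with a.fst = v, f (I.idArc a) := by
  symm
  refine Finset.sum_bij
    (fun a _ => (I.ident a.snd, I.weight a.fst a.snd, I.weight a.snd a.fst)) ?_ ?_ ?_ ?_
  · intro a ha
    obtain rfl := (Finset.mem_filter.mp ha).2
    exact I.mem_edges.mpr ⟨a.snd, a.adj, rfl⟩
  · intro a ha b hb h
    have h1 := (Finset.mem_filter.mp ha).2
    have h2 := (Finset.mem_filter.mp hb).2
    exact SimpleGraph.Dart.ext _ _ (Prod.ext (h1.trans h2.symm)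
      (I.ident_injective (Prod.ext_iff.mp h).1))
  · intro e he
    obtain ⟨u, hu, rfl⟩ := I.mem_edges.mp he
    exact ⟨⟨(v, u), hu⟩, by simp, rfl⟩
  · intro a ha
    obtain rfl := (Finset.mem_filter.mp ha).2
    rfl

open Classical in
theorem sum_edges_in {M : Type*} [AddCommMonoid M] (ε : ℝ) (v : Fin n) (f : IdArc → M) :
    ∑ e ∈ (I.nodeInput ε v).edges, f (e.1, I.ident v, e.2.2) =
      ∑ a : I.graph.Dart with a.snd = v, f (I.idArc a) := by
  symm
  refine Finset.sum_bij
    (fun a _ => (I.ident a.fst, I.weight a.snd a.fst, I.weight a.fst a.snd)) ?_ ?_ ?_ ?_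
  · intro a ha
    obtain rfl := (Finset.mem_filter.mp ha).2
    exact I.mem_edges.mpr ⟨a.fst, a.adj.symm, rfl⟩
  · intro a ha b hb h
    have h1 := (Finset.mem_filter.mp ha).2
    have h2 := (Finset.mem_filter.mp hb).2
    exact SimpleGraph.Dart.ext _ _ (Prod.ext (I.ident_injective (Prod.ext_iff.mp h).1)
      (h1.trans h2.symm))
  · intro e he
    obtain ⟨u, hu, rfl⟩ := I.mem_edges.mp he
    exact ⟨⟨(u, v), hu.symm⟩, by simp, rfl⟩
  · intro a ha
    obtain rfl := (Finset.mem_filter.mp ha).2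
    rfl

open Classical in
/-- The flow `h` on the arcs in `H` as a flow on darts. -/
noncomputable def dartFlow (H : Finset IdArc) (h : IdArc → ℝ) (a : I.graph.Dart) : ℝ :=
  if I.idArc a ∈ H then h (I.idArc a) else 0

theorem dartFlow_eq_sum {H : Finset IdArc} (hH : ∀ e ∈ H, ∃ a, I.idArc a = e) (h : IdArc → ℝ)
    (a : I.graph.Dart) :
    ∑ e ∈ H with e.1 = I.ident a.fst ∧ e.2.1 = I.ident a.snd, h e = I.dartFlow H h a := by
  classical
  have h1 : ∀ e ∈ H, (e.1 = I.ident a.fst ∧ e.2.1 = I.ident a.snd ↔ e = I.idArc a) := by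
    intro e he
    obtain ⟨b, rfl⟩ := hH e he
    constructor
    · rintro ⟨h2, h3⟩
      have h4 : b = a := SimpleGraph.Dart.ext _ _
        (Prod.ext (I.ident_injective h2) (I.ident_injective h3))
      rw [h4]
    · intro h2
      obtain rfl := I.idArc_injective h2
      exact ⟨rfl, rfl⟩
  rw [Finset.filter_congr h1, Finset.sum_filter, Finset.sum_ite_eq', dartFlow]

open Classical in
theorem sum_dartFlow {H : Finset IdArc} (hH : ∀ e ∈ H, ∃ a, I.idArc a = e) (h φ : IdArc → ℝ) :
    ∑ a : I.graph.Dart, I.dartFlow H h a * φ (I.idArc a) = ∑ e ∈ H, h e * φ e := by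
  simp only [dartFlow, ite_mul, zero_mul]
  rw [← Finset.sum_filter]
  refine Finset.sum_bij (fun a _ => I.idArc a) (fun a ha => (Finset.mem_filter.mp ha).2)
    (fun a _ b _ hab => I.idArc_injective hab) (fun e he => ?_) (fun _ _ => rfl)
  obtain ⟨a, rfl⟩ := hH e he
  exact ⟨a, by simp [he], rfl⟩

open Classical in
theorem sum_dartFlow_snd {H : Finset IdArc} (hH : ∀ e ∈ H, ∃ a, I.idArc a = e) (h : IdArc → ℝ)
    (v : Fin n) : ∑ a : I.graph.Dart with a.snd = v, I.dartFlow H h a =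
      ∑ e ∈ H with e.2.1 = I.ident v, h e := by
  have h1 := I.sum_dartFlow hH h fun e => if e.2.1 = I.ident v then 1 else 0
  simp only [mul_ite, mul_one, mul_zero] at h1
  rw [Finset.sum_filter, Finset.sum_filter, ← h1]
  refine Finset.sum_congr rfl fun a _ => if_congr ?_ rfl rfl
  exact I.ident_injective.eq_iff.symm

open Classical in
theorem sum_dartFlow_fst {H : Finset IdArc} (hH : ∀ e ∈ H, ∃ a, I.idArc a = e) (h : IdArc → ℝ)
    (v : Fin n) : ∑ a : I.graph.Dart with a.fst = v, I.dartFlow H h a =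
      ∑ e ∈ H with e.1 = I.ident v, h e := by
  have h1 := I.sum_dartFlow hH h fun e => if e.1 = I.ident v then 1 else 0
  simp only [mul_ite, mul_one, mul_zero] at h1
  rw [Finset.sum_filter, Finset.sum_filter, ← h1]
  refine Finset.sum_congr rfl fun a _ => if_congr ?_ rfl rfl
  exact I.ident_injective.eq_iff.symm

open Classical in
theorem sum_symm_snd (f : I.graph.Dart → ℝ) (v : Fin n) :
    ∑ a : I.graph.Dart with a.snd = v, f a.symm = ∑ a : I.graph.Dart with a.fst = v, f a := by
  rw [Finset.sum_filter, Finset.sum_filter, ← I.sum_darts_symm]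
  rfl

/-- The net flow that consists of `μ` times the flow `r` and the flow `h` on the arcs in `H`. -/
noncomputable def netFlow (μ : ℝ) (r : I.graph.Dart → ℝ) (H : Finset IdArc) (h : IdArc → ℝ)
    (a : I.graph.Dart) : ℝ :=
  μ * (r a - r a.symm) + (I.dartFlow H h a - I.dartFlow H h a.symm)

open Classical in
/-- A correct answer of the oracle determines a flow of bounded cost. -/
theorem oracleAnswer_flow {b : ℕ → ℤ} (hb : ∀ v, b (I.ident v) = I.demand v) {H : Finset IdArc}
    (hH : ∀ e ∈ H, ∃ a, I.idArc a = e) {g : ℕ → ℝ} {c : ℝ} {x : OracleAnswer}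
    (hx : x.Correct I.ids b H g c) (r : I.graph.Dart → ℝ) (hr : ∀ a, 0 ≤ r a)
    (hg : ∀ v, g (I.ident v) = ∑ a : I.graph.Dart with a.snd = v, r a
      - ∑ a : I.graph.Dart with a.fst = v, r a)
    (hc : c = ∑ a, r a * I.arcCost a) :
    I.IsFlow (I.netFlow x.scale r H x.spannerFlow) ∧
      I.cost (I.netFlow x.scale r H x.spannerFlow) ≤ ∑ i ∈ I.ids, b i * x.potential i := by
  have hnn : ∀ a, 0 ≤ I.dartFlow H x.spannerFlow a := by
    intro a
    rw [dartFlow]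
    split_ifs with h
    · exact hx.flow_nonneg _ h
    · exact le_rfl
  refine ⟨⟨fun a => ?_, fun v => ?_⟩, ?_⟩
  · simp only [netFlow, SimpleGraph.Dart.symm_symm]
    ring
  · simp only [netFlow]
    rw [Finset.sum_add_distrib, ← Finset.mul_sum, Finset.sum_sub_distrib, Finset.sum_sub_distrib,
      I.sum_symm_snd, I.sum_symm_snd, ← hg, I.sum_dartFlow_snd hH, I.sum_dartFlow_fst hH,
      hx.balance _ (Finset.mem_image_of_mem _ (Finset.mem_univ v)), hb]
  -- Cancellation of opposite arcs only lowers the cost, so the net flow costs at most as much as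
  -- its nonnegative parts.
  · refine le_trans ?_ hx.optimal
    have h1 : ∑ e ∈ H, x.spannerFlow e * e.2.2 =
        ∑ a : I.graph.Dart, I.dartFlow H x.spannerFlow a * I.arcCost a :=
      (I.sum_dartFlow hH x.spannerFlow fun e => (e.2.2 : ℝ)).symm
    rw [h1, hc, Finset.mul_sum, ← Finset.sum_add_distrib, cost, pNorm]
    refine Finset.sum_le_sum fun a _ => ?_
    have h0 : 0 ≤ I.arcCost a := by linarith [I.arcCost_pos a]
    have h2 := mul_nonneg hx.scale_nonneg (mul_nonneg (hr a) h0)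
    have h3 := mul_nonneg (hnn a) h0
    refine max_le (by linarith) ?_
    have h4 := mul_nonneg h0 (mul_nonneg hx.scale_nonneg (hr a.symm))
    have h5 := mul_nonneg h0 (hnn a.symm)
    simp only [netFlow]
    linarith

open Classical in
-- Summation by parts turns the constraint on node balances into the weighted average of stretches.
-- This is why sums per node carry all the information needed.
theorem oracleAnswer_constraint {b : ℕ → ℤ} {H : Finset IdArc} {g : ℕ → ℝ} {c : ℝ}
    {x : OracleAnswer} (hx : x.Correct I.ids b H g c) (r : I.graph.Dart → ℝ)
    (hg : ∀ v, g (I.ident v) = ∑ a : I.graph.Dart with a.snd = v, r a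
      - ∑ a : I.graph.Dart with a.fst = v, r a) :
    ∑ a : I.graph.Dart,
      r a * (x.potential (I.ident a.snd) - x.potential (I.ident a.fst)) ≤ c := by
  refine le_of_eq_of_le ?_ hx.constraint
  rw [I.sum_ids fun i => g i * x.potential i]
  simp only [hg, sub_mul, Finset.sum_sub_distrib, mul_sub]
  rw [I.sum_darts_snd r fun v => x.potential (I.ident v),
    I.sum_darts_fst r fun v => x.potential (I.ident v)]

end Transshipment

/-! ### The common knowledge, round by round -/

namespace Transshipment

variable {n : ℕ} (I : Transshipment n) (ε : ℝ)

/-- The common knowledge after `t` rounds. -/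
noncomputable def knowledge (t : ℕ) : Knowledge := transshipmentProtocol.common I ε t

/-- The messages of round `t`, indexed by the identifiers of the senders. -/
noncomputable def boardAt (t : ℕ) (i : ℕ) : Message :=
  ∑ v with I.ident v = i, Knowledge.message (I.nodeInput ε v) (I.knowledge ε t)

theorem knowledge_succ (t : ℕ) :
    I.knowledge ε (t + 1) = (I.knowledge ε t).update ε I.ids (I.boardAt ε t) := rfl

theorem boardAt_ident (t : ℕ) (v : Fin n) :
    I.boardAt ε t (I.ident v) = Knowledge.message (I.nodeInput ε v) (I.knowledge ε t) := by
  have : (Finset.univ.filter fun u => I.ident u = I.ident v) = {v} := by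
    ext u
    simp [I.ident_injective.eq_iff]
  rw [boardAt, this, Finset.sum_singleton]

/-- The parameters of the instance are common knowledge. -/
structure Knows (k : Knowledge) : Prop where
  ids : k.ids = I.ids
  demand : ∀ v, k.demand (I.ident v) = I.demand v
  ratio : k.ratio = I.ratioBound
  maxWeight : k.maxWeight = I.weightBound

theorem Knows.card {I : Transshipment n} {k : Knowledge} (h : I.Knows k) : k.ids.card = n := by
  rw [h.ids, I.card_ids]

theorem knowledge_one : I.Knows (I.knowledge ε 1) ∧ (I.knowledge ε 1).round = 1 ∧
    (I.knowledge ε 1).arcs = ∅ ∧ (I.knowledge ε 1).potential = fun _ => 0 := by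
  have hr : (I.knowledge ε 0).round = 0 := rfl
  have hm : ∀ v, I.boardAt ε 0 (I.ident v) =
      ((I.nodeInput 0 v).edges.sup fun e => ⌈(e.2.1 : ℝ) / e.2.2⌉₊,
        (I.nodeInput 0 v).edges.sup fun e => e.2.1,
        (I.demand v).toNat, (-I.demand v).toNat) := by
    intro v
    rw [boardAt_ident, Knowledge.message, if_pos hr]
    rfl
  rw [I.knowledge_succ ε 0, Knowledge.update, if_pos hr]
  refine ⟨⟨rfl, fun v => ?_, ?_, ?_⟩, rfl, rfl, rfl⟩
  · simp only [hm]
    exact Int.toNat_sub_toNat_neg _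
  · simp only [ids, ratioBound, Finset.sup_image]
    congr 2
    funext v
    simp only [Function.comp, hm]
  · simp only [ids, weightBound, Finset.sup_image]
    congr 1
    funext v
    simp only [Function.comp, hm]

theorem message_of_knows_spanner {k : Knowledge} (h1 : I.Knows k) {t : ℕ}
    (ht : t < spannerRounds ε n) (h2 : k.round = 1 + t) (h3 : k.arcs = I.spanner ε t)
    (v : Fin n) : Knowledge.message (I.nodeInput ε v) k =
      ((pickEdge (I.spannerStretch ε) (I.spanner ε t) (I.ident v) (I.nodeInput ε v).edges).1,
        (pickEdge (I.spannerStretch ε) (I.spanner ε t) (I.ident v) (I.nodeInput ε v).edges).2.1,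
        (pickEdge (I.spannerStretch ε) (I.spanner ε t) (I.ident v) (I.nodeInput ε v).edges).2.2,
        0) := by
  have h0 : k.round ≠ 0 := by omega
  have hle : k.round ≤ spannerRounds (I.nodeInput ε v).eps k.ids.card := by
    rw [h1.card, h2]
    change _ ≤ spannerRounds ε n
    omega
  rw [Knowledge.message, if_neg h0, if_pos hle, h1.card, h1.ratio, h3]
  rfl

theorem knowledge_spanner (t : ℕ) (ht : t ≤ spannerRounds ε n) :
    I.Knows (I.knowledge ε (1 + t)) ∧ (I.knowledge ε (1 + t)).round = 1 + t ∧
      (I.knowledge ε (1 + t)).arcs = I.spanner ε t ∧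
      (I.knowledge ε (1 + t)).potential = fun _ => 0 := by
  induction t with
  | zero => exact I.knowledge_one ε
  | succ t ih =>
    obtain ⟨h1, h2, h3, h4⟩ := ih (by omega)
    have hle : (I.knowledge ε (1 + t)).round ≤
        spannerRounds ε (I.knowledge ε (1 + t)).ids.card := by
      rw [h1.card, h2]
      omega
    have h0 : (I.knowledge ε (1 + t)).round ≠ 0 := by omega
    rw [← add_assoc, knowledge_succ, Knowledge.update, if_neg h0, if_pos hle]
    refine ⟨⟨h1.ids, h1.demand, h1.ratio, h1.maxWeight⟩, by simp only [h2], ?_, h4⟩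
    simp only [h3, spanner]
    congr 1
    rw [h1.ids, ids, Finset.image_biUnion]
    refine Finset.biUnion_congr rfl fun v _ => ?_
    simp only [boardAt_ident, I.message_of_knows_spanner ε h1 (t := t) (by omega) h2 h3]

/-- The common knowledge after `t` iterations of the multiplicative weights method. -/
noncomputable def iterate (t : ℕ) : Knowledge := I.knowledge ε (1 + spannerRounds ε n + t)

/-- The rounded weights in iteration `t`, divided by the costs. -/
noncomputable def dartRate (t : ℕ) (a : I.graph.Dart) : ℕ :=
  rate ε n I.ratioBound I.weightBound t (I.iterate ε t).potential
    (I.ident a.fst) (I.ident a.snd) (I.weight a.fst a.snd)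

/-- The answer of the oracle in iteration `t`. -/
noncomputable def answerAt (t : ℕ) : OracleAnswer :=
  (I.iterate ε t).answer (I.boardAt ε (1 + spannerRounds ε n + t))

/-- The value of the answer of the oracle in iteration `t`. -/
noncomputable def valueAt (t : ℕ) : ℝ :=
  ∑ v, I.demand v * (I.answerAt ε t).potential (I.ident v)

/-- The flow that is found in iteration `t`. -/
noncomputable def recordAt (t : ℕ) : FlowRecord :=
  ⟨I.valueAt ε t, I.answerAt ε t, (I.iterate ε t).potential, t⟩

theorem iterate_spec (t : ℕ) :
    I.Knows (I.iterate ε t) ∧ (I.iterate ε t).round = 1 + spannerRounds ε n + t ∧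
      (I.iterate ε t).arcs = I.spannerArcs ε := by
  induction t with
  | zero =>
    obtain ⟨h1, h2, h3, -⟩ := I.knowledge_spanner ε (spannerRounds ε n) le_rfl
    exact ⟨h1, h2, h3⟩
  | succ t ih =>
    obtain ⟨h1, h2, h3⟩ := ih
    have hle : ¬ (I.iterate ε t).round ≤ spannerRounds ε (I.iterate ε t).ids.card := by
      rw [h1.card, h2]
      omega
    have h0 : (I.iterate ε t).round ≠ 0 := by omega
    have : I.iterate ε (t + 1) = (I.iterate ε t).update ε I.ids
      (I.boardAt ε (1 + spannerRounds ε n + t)) := rfl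
    rw [this, Knowledge.update, if_neg h0, if_neg hle]
    exact ⟨⟨h1.ids, h1.demand, h1.ratio, h1.maxWeight⟩, by simp only [h2]; rfl, h3⟩

theorem iterate_zero_potential : (I.iterate ε 0).potential = fun _ => 0 :=
  (I.knowledge_spanner ε (spannerRounds ε n) le_rfl).2.2.2

theorem answerValue_iterate (t : ℕ) :
    (I.iterate ε t).answerValue (I.boardAt ε (1 + spannerRounds ε n + t)) = I.valueAt ε t := by
  obtain ⟨h1, -⟩ := I.iterate_spec ε t
  rw [Knowledge.answerValue, h1.ids, I.sum_ids fun i => ((I.iterate ε t).demand i : ℝ) * _]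
  simp only [h1.demand]
  rfl

open Classical in
theorem iterate_succ (t : ℕ) :
    (I.iterate ε (t + 1)).potential =
        (fun i => (I.iterate ε t).potential i + (I.answerAt ε t).potential i) ∧
      (I.iterate ε (t + 1)).best =
        if t = 0 ∨ I.valueAt ε t < (I.iterate ε t).best.value then I.recordAt ε t
        else (I.iterate ε t).best := by
  obtain ⟨h1, h2, h3⟩ := I.iterate_spec ε t
  have hle : ¬ (I.iterate ε t).round ≤ spannerRounds ε (I.iterate ε t).ids.card := by
    rw [h1.card, h2]
    omega
  have h0 : (I.iterate ε t).round ≠ 0 := by omega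
  have : I.iterate ε (t + 1) = (I.iterate ε t).update ε I.ids
    (I.boardAt ε (1 + spannerRounds ε n + t)) := rfl
  rw [this, Knowledge.update, if_neg h0, if_neg hle]
  refine ⟨rfl, ?_⟩
  simp only [I.answerValue_iterate]
  refine if_congr (or_congr ?_ Iff.rfl) ?_ rfl
  · rw [h1.card, h2]
    omega
  · simp only [recordAt, h1.card, h2, FlowRecord.mk.injEq, true_and]
    exact ⟨rfl, by omega⟩

open Classical in
theorem message_iterate (t : ℕ) (v : Fin n) :
    Knowledge.message (I.nodeInput ε v) (I.iterate ε t) =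
      (∑ a : I.graph.Dart with a.snd = v, I.dartRate ε t a,
        ∑ a : I.graph.Dart with a.fst = v, I.dartRate ε t a,
        ∑ a : I.graph.Dart with a.fst = v, I.dartRate ε t a * I.weight a.fst a.snd, 0) := by
  obtain ⟨h1, h2, h3⟩ := I.iterate_spec ε t
  have hle : ¬ (I.iterate ε t).round ≤
      spannerRounds (I.nodeInput ε v).eps (I.iterate ε t).ids.card := by
    rw [h1.card, h2]
    change ¬ _ ≤ spannerRounds ε n
    omega
  have h0 : (I.iterate ε t).round ≠ 0 := by omega
  have hrate : (I.iterate ε t).currentRate (I.nodeInput ε v).eps =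
      rate ε n I.ratioBound I.weightBound t (I.iterate ε t).potential := by
    rw [Knowledge.currentRate, h1.card, h1.ratio, h1.maxWeight, h2]
    change rate ε n _ _ (1 + spannerRounds ε n + t - 1 - spannerRounds ε n) _ = _
    congr 1
    omega
  rw [Knowledge.message, if_neg h0, if_neg hle, hrate]
  refine Prod.ext ?_ (Prod.ext ?_ (Prod.ext ?_ rfl))
  · exact I.sum_edges_in ε v fun e => rate ε n I.ratioBound I.weightBound t
      (I.iterate ε t).potential e.1 e.2.1 e.2.2
  · exact I.sum_edges_out ε v fun e => rate ε n I.ratioBound I.weightBound t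
      (I.iterate ε t).potential e.1 e.2.1 e.2.2
  · exact I.sum_edges_out ε v fun e => rate ε n I.ratioBound I.weightBound t
      (I.iterate ε t).potential e.1 e.2.1 e.2.2 * e.2.2

open Classical in
/-- The answers of the oracle are correct, and each of them determines a flow. -/
theorem answerAt_spec (t : ℕ) :
    Feasible (I.spannerArcs ε) (I.answerAt ε t).potential ∧
    (∑ a : I.graph.Dart, (I.dartRate ε t a : ℝ) * ((I.answerAt ε t).potential (I.ident a.snd) -
        (I.answerAt ε t).potential (I.ident a.fst)) ≤
      ∑ a : I.graph.Dart, (I.dartRate ε t a : ℝ) * I.arcCost a) ∧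
    I.IsFlow (I.netFlow (I.answerAt ε t).scale (fun a => I.dartRate ε t a) (I.spannerArcs ε)
      (I.answerAt ε t).spannerFlow) ∧
    I.cost (I.netFlow (I.answerAt ε t).scale (fun a => I.dartRate ε t a) (I.spannerArcs ε)
      (I.answerAt ε t).spannerFlow) ≤ I.valueAt ε t := by
  obtain ⟨h1, h2, h3⟩ := I.iterate_spec ε t
  set m := I.boardAt ε (1 + spannerRounds ε n + t) with hm
  have hmv : ∀ v, m (I.ident v) = _ := fun v =>
    (I.boardAt_ident ε (1 + spannerRounds ε n + t) v).trans (I.message_iterate ε t v)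
  have hc : ∑ i ∈ I.ids, ((m i).2.2.1 : ℝ) =
      ∑ a : I.graph.Dart, (I.dartRate ε t a : ℝ) * I.arcCost a := by
    rw [I.sum_ids fun i => ((m i).2.2.1 : ℝ)]
    simp only [hmv]
    push_cast
    exact Finset.sum_fiberwise Finset.univ (fun a : I.graph.Dart => a.fst) _
  have hcorrect : (I.answerAt ε t).Correct I.ids (I.iterate ε t).demand (I.spannerArcs ε)
      (fun i => ((m i).1 : ℝ) - (m i).2.1) (∑ i ∈ I.ids, ((m i).2.2.1 : ℝ)) := by
    rw [answerAt, Knowledge.answer, oracle, h1.ids, h3]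
    -- The right-hand side of the averaged constraint is a sum of natural numbers, so a correct
    -- answer exists.
    exact Classical.epsilon_spec (I.exists_correct ε _ h1.demand _ _
      (Finset.sum_nonneg fun i _ => Nat.cast_nonneg _))
  have hg : ∀ v, ((m (I.ident v)).1 : ℝ) - (m (I.ident v)).2.1 =
      ∑ a : I.graph.Dart with a.snd = v, (I.dartRate ε t a : ℝ)
        - ∑ a : I.graph.Dart with a.fst = v, (I.dartRate ε t a : ℝ) := by
    intro v
    rw [hmv]
    push_cast
    rfl
  have hH : ∀ e ∈ I.spannerArcs ε, ∃ a, I.idArc a = e := by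
    intro e he
    obtain ⟨u, v, huv, rfl⟩ := I.spanner_sound ε _ he
    exact ⟨⟨(u, v), huv⟩, rfl⟩
  have h4 := I.oracleAnswer_flow h1.demand hH hcorrect (fun a => I.dartRate ε t a)
    (fun a => Nat.cast_nonneg _) hg hc
  refine ⟨hcorrect.feasible, ?_, h4.1, h4.2.trans (le_of_eq ?_)⟩
  · rw [← hc]
    exact I.oracleAnswer_constraint hcorrect (fun a => (I.dartRate ε t a : ℝ)) hg
  · rw [I.sum_ids fun i => ((I.iterate ε t).demand i : ℝ) * _]
    simp only [h1.demand]
    rfl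

/-- The best flow that has been found so far. -/
theorem best_spec (t : ℕ) (ht : 0 < t) :
    (∃ s, (I.iterate ε t).best = I.recordAt ε s) ∧
      ∀ s < t, (I.iterate ε t).best.value ≤ I.valueAt ε s := by
  classical
  induction t with
  | zero => omega
  | succ t ih =>
    rw [(I.iterate_succ ε t).2]
    split_ifs with h
    · refine ⟨⟨t, rfl⟩, fun s hs => ?_⟩
      change I.valueAt ε t ≤ _
      rcases Nat.lt_succ_iff_lt_or_eq.mp hs with hs | rfl
      · rcases h with rfl | h
        · omega
        · exact h.le.trans ((ih (by omega)).2 s hs)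
      · exact le_rfl
    · push Not at h
      obtain ⟨h1, h2⟩ := ih (Nat.pos_of_ne_zero h.1)
      refine ⟨h1, fun s hs => ?_⟩
      rcases Nat.lt_succ_iff_lt_or_eq.mp hs with hs | rfl
      · exact h2 s hs
      · exact h.2

/-- The dual objective is linear, so the accumulated potential has the sum of the values found, and
the smallest value is at most their average. -/
theorem best_value_le (t : ℕ) (ht : 0 < t) :
    t * (I.iterate ε t).best.value ≤ ∑ v, I.demand v * (I.iterate ε t).potential (I.ident v) := by
  have h1 : ∀ t, ∑ v, (I.demand v : ℝ) * (I.iterate ε t).potential (I.ident v) =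
      ∑ s ∈ Finset.range t, I.valueAt ε s := by
    intro t
    induction t with
    | zero => simp [iterate_zero_potential]
    | succ t ih =>
      rw [Finset.sum_range_succ, ← ih, valueAt, ← Finset.sum_add_distrib]
      simp only [(I.iterate_succ ε t).1, mul_add]
  rw [h1]
  have h2 := Finset.card_nsmul_le_sum (Finset.range t) (I.valueAt ε) _
    fun s hs => (I.best_spec ε t ht).2 s (Finset.mem_range.mp hs)
  simpa using h2

end Transshipment

/-! ### Convergence and correctness of the output -/

namespace Transshipment

variable {n : ℕ} (I : Transshipment n) (ε : ℝ)

/-- The weight of an arc in iteration `t`. -/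
noncomputable def dartWeight (t : ℕ) (a : I.graph.Dart) : ℝ :=
  Real.exp (ε / (36 * width ε n I.ratioBound ^ 2) *
    (((I.iterate ε t).potential (I.ident a.snd) - (I.iterate ε t).potential (I.ident a.fst)) /
      I.arcCost a - t * (1 + ε / 2)))

theorem dartRate_eq (t : ℕ) (a : I.graph.Dart) : I.dartRate ε t a =
    ⌊precision ε n I.ratioBound I.weightBound * I.dartWeight ε t a / I.arcCost a⌋₊ := rfl

theorem one_le_ratioBound_real : (1 : ℝ) ≤ I.ratioBound := by exact_mod_cast I.one_le_ratioBound

theorem one_le_width : 1 ≤ width ε n I.ratioBound :=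
  one_le_mul_of_one_le_of_one_le (I.one_le_spannerStretch ε) I.one_le_ratioBound_real

/-- A stretch is bounded from below through the reverse arc, whose cost may be larger by
`ratioBound`. Hence the second such factor in `width`. -/
theorem abs_stretch_le {y : ℕ → ℝ} (hy : Feasible (I.spannerArcs ε) y) (a : I.graph.Dart) :
    |(y (I.ident a.snd) - y (I.ident a.fst)) / I.arcCost a| ≤ width ε n I.ratioBound := by
  have h0 : 0 < I.arcCost a := by linarith [I.arcCost_pos a]
  have hβ : 0 ≤ I.spannerStretch ε := by linarith [I.one_le_spannerStretch ε]
  rw [abs_div, abs_of_pos h0, div_le_iff₀ h0, abs_le, width]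
  have h1 := I.stretch_le ε hy a.adj
  have h2 := I.stretch_le ε hy a.adj.symm
  have h3 := mul_le_mul_of_nonneg_left (I.weight_le_ratioBound_mul a.adj.symm) hβ
  have h4 := mul_le_mul_of_nonneg_left
    (le_mul_of_one_le_left h0.le I.one_le_ratioBound_real) hβ
  change I.spannerStretch ε * (I.weight a.fst a.snd) ≤ _ at h4
  change -(I.spannerStretch ε * I.ratioBound * _) ≤ _ ∧ _ ≤ I.spannerStretch ε * I.ratioBound * _
  rw [arcCost] at *
  constructor <;> linarith

open Classical in
-- All weights start at `1`, and the averaged constraint obeyed by the oracle is precisely what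
-- `mwu_step` needs. The bound also limits the size of the messages.
theorem sum_dartWeight_le (hε : 0 < ε) (hε1 : ε ≤ 1) (hn : ¬ ε * n < 1) (t : ℕ) :
    ∑ a, I.dartWeight ε t a ≤ Fintype.card I.graph.Dart := by
  induction t with
  | zero => simp [dartWeight, iterate_zero_potential]
  | succ t ih =>
    obtain ⟨h1, h2, -⟩ := I.answerAt_spec ε t
    have hM : 12 * width ε n I.ratioBound * I.weightBound ≤
        ε * precision ε n I.ratioBound I.weightBound := by
      rw [precision, if_neg hn, ← div_le_iff₀' hε]
      exact Nat.le_ceil _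
    have h3 := mwu_step (I.dartWeight ε t)
      (fun a => ((I.answerAt ε t).potential (I.ident a.snd) -
        (I.answerAt ε t).potential (I.ident a.fst)) / I.arcCost a) I.arcCost I.weightBound ε
      (width ε n I.ratioBound) (precision ε n I.ratioBound I.weightBound)
      (fun a => (Real.exp_pos _).le) I.arcCost_pos
      (fun a => by rw [arcCost]; exact_mod_cast I.weight_le_weightBound a.adj) hε hε1
      (I.one_le_width ε) (I.abs_stretch_le ε h1) hM (by
        simp only [← dartRate_eq]
        refine le_of_eq_of_le (Finset.sum_congr rfl fun a _ => ?_) h2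
        have h0 : I.arcCost a ≠ 0 := by linarith [I.arcCost_pos a]
        rw [mul_assoc, mul_div_cancel₀ _ h0]) ih
    refine le_of_eq_of_le (Finset.sum_congr rfl fun a _ => ?_) h3
    rw [dartWeight, dartWeight, ← Real.exp_add, (I.iterate_succ ε t).1]
    congr 1
    push_cast
    ring

open Classical in
theorem card_dart_le : Fintype.card I.graph.Dart ≤ n ^ 2 := by
  have := Fintype.card_le_of_injective (fun a : I.graph.Dart => a.toProd)
    SimpleGraph.Dart.toProd_injective
  rw [Fintype.card_prod, Fintype.card_fin] at this
  linarith

theorem one_le_iterations : 1 ≤ iterations ε n I.ratioBound := by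
  rw [iterations]
  split_ifs <;> omega

theorem stretch_iterate_le (hε : 0 < ε) (hε1 : ε ≤ 1) (a : I.graph.Dart) :
    (I.iterate ε (iterations ε n I.ratioBound)).potential (I.ident a.snd) -
        (I.iterate ε (iterations ε n I.ratioBound)).potential (I.ident a.fst) ≤
      iterations ε n I.ratioBound * (1 + ε) * I.arcCost a := by
  classical
  have h0 : 0 < I.arcCost a := by linarith [I.arcCost_pos a]
  by_cases hn : ε * n < 1
  · have hT : iterations ε n I.ratioBound = 0 + 1 := by rw [iterations, if_pos hn]
    have hβ : I.spannerStretch ε = 1 := by rw [spannerStretch, stretch, if_pos hn]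
    rw [hT, (I.iterate_succ ε 0).1, iterate_zero_potential]
    have h1 := I.stretch_le ε (I.answerAt_spec ε 0).1 a.adj
    rw [hβ] at h1
    have h2 := mul_pos hε h0
    rw [arcCost] at *
    push_cast
    linarith
  · set T := iterations ε n I.ratioBound with hT
    set m := Fintype.card I.graph.Dart with hm
    have hm0 : 0 < m := Fintype.card_pos_iff.mpr ⟨a⟩
    have hm0' : (0 : ℝ) < m := by exact_mod_cast hm0
    have hn0 : (0 : ℝ) < n := by
      by_contra hc
      exact hn (by nlinarith)
    -- There are at most `n ^ 2` darts, which turns the constant `72` of `mwu_final` into the `144`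
    -- of `iterations`.
    have hlog : Real.log m ≤ 2 * Real.log n := by
      rw [← Real.log_rpow hn0]
      refine Real.log_le_log hm0' ?_
      have := I.card_dart_le
      norm_cast
    have hρ := I.one_le_width ε
    have hTm : 72 * width ε n I.ratioBound ^ 2 * Real.log m / ε ^ 2 ≤ T := by
      rw [hT, iterations, if_neg hn]
      push_cast
      refine le_trans ?_ ((Nat.le_ceil _).trans (le_add_of_nonneg_right zero_le_one))
      gcongr ?_ / _
      have h1 : 0 < width ε n I.ratioBound ^ 2 := by positivity
      nlinarith
    have h1 : I.dartWeight ε T a ≤ m :=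
      (Finset.single_le_sum (f := I.dartWeight ε T) (fun a _ => (Real.exp_pos _).le)
        (Finset.mem_univ a)).trans
        (I.sum_dartWeight_le ε hε hε1 hn T)
    have h2 := mwu_final m _ ε _ T hε hρ hm0' hTm h1
    rwa [div_le_iff₀ h0] at h2

/-- The number of rounds of the algorithm. -/
noncomputable def rounds : ℕ := 1 + spannerRounds ε n + iterations ε n I.ratioBound

theorem knowledge_round (t : ℕ) (ht : 1 ≤ t) :
    I.Knows (I.knowledge ε t) ∧ (I.knowledge ε t).round = t := by
  obtain ⟨s, rfl⟩ := Nat.exists_eq_add_of_le ht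
  rcases le_total s (spannerRounds ε n) with h | h
  · obtain ⟨h1, h2, -⟩ := I.knowledge_spanner ε s h
    exact ⟨h1, h2⟩
  · obtain ⟨r, rfl⟩ := Nat.exists_eq_add_of_le h
    obtain ⟨h1, h2, -⟩ := I.iterate_spec ε r
    rw [← add_assoc]
    exact ⟨h1, h2⟩

theorem done_iff (t : ℕ) (ht : 1 ≤ t) :
    (I.knowledge ε t).Done ε ↔ t = I.rounds ε := by
  obtain ⟨h1, h2⟩ := I.knowledge_round ε t ht
  rw [Knowledge.Done, h1.card, h1.ratio, h2, rounds]

theorem not_done (t : ℕ) (ht : t < I.rounds ε) : ¬ (I.knowledge ε t).Done ε := by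
  rcases Nat.eq_zero_or_pos t with rfl | h0
  · intro h
    -- Before the first round `ids` is still empty, but the target round is at least `1` in any
    -- case.
    have h1 : (0 : ℕ) = _ := h
    omega
  · rw [I.done_iff ε t h0]
    exact ht.ne

theorem done_rounds : (I.knowledge ε (I.rounds ε)).Done ε := by
  rw [I.done_iff ε _ (by rw [rounds]; omega)]

theorem result_flow {k : Knowledge} (h1 : I.Knows k) (h2 : k.arcs = I.spannerArcs ε) {s : ℕ}
    (h3 : k.best = I.recordAt ε s) (a : I.graph.Dart) :
    (k.result (I.nodeInput ε a.fst)).flow (I.ident a.snd) =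
      I.netFlow (I.answerAt ε s).scale (fun a => I.dartRate ε s a) (I.spannerArcs ε)
        (I.answerAt ε s).spannerFlow a := by
  classical
  have hH : ∀ e ∈ I.spannerArcs ε, ∃ a, I.idArc a = e := by
    intro e he
    obtain ⟨u, v, huv, rfl⟩ := I.spanner_sound ε _ he
    exact ⟨⟨(u, v), huv⟩, rfl⟩
  have h4 : ((I.nodeInput ε a.fst).edges.filter fun e => e.1 = I.ident a.snd) =
      {(I.ident a.snd, I.weight a.fst a.snd, I.weight a.snd a.fst)} := by
    ext e
    simp only [Finset.mem_filter, mem_edges, Finset.mem_singleton]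
    constructor
    · rintro ⟨⟨u, hu, rfl⟩, h⟩
      rw [I.ident_injective h]
    · rintro rfl
      exact ⟨⟨_, a.adj, rfl⟩, rfl⟩
  rw [netFlow, ← I.dartFlow_eq_sum hH, ← I.dartFlow_eq_sum hH]
  simp only [Knowledge.result, h4, Finset.sum_singleton, h1.card, h1.ratio, h1.maxWeight, h2, h3]
  rfl

theorem result_isApproxSolution (hε : 0 < ε) (hε1 : ε ≤ 1) :
    I.IsApproxSolution ε fun v =>
      (I.knowledge ε (I.rounds ε)).result (I.nodeInput ε v) := by
  have hk : I.knowledge ε (I.rounds ε) = I.iterate ε (iterations ε n I.ratioBound) := rfl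
  rw [hk]
  set T := iterations ε n I.ratioBound with hT
  have hT1 : 0 < T := I.one_le_iterations ε
  have hT0 : (0 : ℝ) < T := by exact_mod_cast hT1
  have hTε : (0 : ℝ) < T * (1 + ε) := by positivity
  obtain ⟨h1, h2, h3⟩ := I.iterate_spec ε T
  obtain ⟨s, hs⟩ := (I.best_spec ε T hT1).1
  obtain ⟨-, -, h4, h5⟩ := I.answerAt_spec ε s
  refine I.isApproxSolution_of hε (I.result_flow ε h1 h3 hs)
    -- The average over `T` iterations, scaled by `1 + ε` to restore feasibility.
    (y := fun v => (I.iterate ε T).potential (I.ident v) / (T * (1 + ε)))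
    (z := (I.iterate ε T).best.value) (fun v u => ?_) (fun v => rfl) h4 ?_ ?_ ?_
  · simp only [Knowledge.result, h1.card, h1.ratio]
    rfl
  · rw [isPotential_iff]
    intro a
    rw [← sub_div, div_le_iff₀' hTε]
    exact I.stretch_iterate_le ε hε hε1 a
  · rw [hs]
    exact h5
  · have h6 := I.best_value_le ε T hT1
    rw [dualValue]
    simp only [mul_div_assoc', ← Finset.sum_div]
    rw [le_div_iff₀ hTε]
    have h7 := mul_le_mul_of_nonneg_left h6 (by linarith : (0 : ℝ) ≤ 1 + ε)
    linarith

end Transshipment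

/-! ### Message length and number of rounds -/

namespace Transshipment

variable {n : ℕ} (I : Transshipment n) (ε : ℝ)

theorem ceil_ratio_le {u v : Fin n} (h : I.graph.Adj u v) :
    ⌈(I.weight u v : ℝ) / I.weight v u⌉₊ ≤ I.weight u v := by
  refine Nat.ceil_le.mpr (div_le_self (Nat.cast_nonneg _) ?_)
  exact_mod_cast I.weight_pos v u h.symm

/-- Outside the case `ε * n < 1` the factor `1 / ε` is at most `n`, so the precision is polynomial
in `n`. This is the purpose of the case distinction. -/
theorem precision_le {B N : ℕ} (hε : 0 < ε) (hn : n ≤ N) (hN : levels n ≤ N)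
    (hL : I.ratioBound ≤ B) (hW : I.weightBound ≤ B) :
    precision ε n I.ratioBound I.weightBound ≤ 24 * B ^ 3 * N ^ 2 := by
  rw [precision]
  split_ifs with h
  · omega
  · rw [Nat.ceil_le, width, stretch, if_neg h, div_le_iff₀ hε]
    have h1 : (levels n : ℝ) ≤ N := by exact_mod_cast hN
    have h2 : (I.ratioBound : ℝ) ≤ B := by exact_mod_cast hL
    have h3 : (I.weightBound : ℝ) ≤ B := by exact_mod_cast hW
    have h4 : (n : ℝ) ≤ N := by exact_mod_cast hn
    have h5 : 1 ≤ N * ε := by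
      have := mul_le_mul_of_nonneg_left h4 hε.le
      linarith
    push_cast
    calc 12 * (2 * (levels n : ℝ) * I.ratioBound * I.ratioBound) * I.weightBound
        ≤ 12 * (2 * (N : ℝ) * B * B) * B := by gcongr
      _ = (24 * B ^ 3 * N) * 1 := by ring
      _ ≤ (24 * B ^ 3 * N) * (N * ε) := mul_le_mul_of_nonneg_left h5 (by positivity)
      _ = _ := by ring

open Classical in
-- The total weight never exceeds the number of darts. As costs are at least `1`, this sum dominates
-- every number sent in an iteration.
theorem sum_dartRate_mul_le (hε : 0 < ε) (hε1 : ε ≤ 1) (t : ℕ) :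
    ∑ a : I.graph.Dart, I.dartRate ε t a * I.weight a.fst a.snd ≤
      precision ε n I.ratioBound I.weightBound * n ^ 2 := by
  by_cases hn : ε * n < 1
  · have h0 : precision ε n I.ratioBound I.weightBound = 0 := by rw [precision, if_pos hn]
    simp [dartRate_eq, h0]
  · set M := precision ε n I.ratioBound I.weightBound with hM
    have h1 : ∀ a : I.graph.Dart,
        (I.dartRate ε t a : ℝ) * I.arcCost a ≤ M * I.dartWeight ε t a := by
      intro a
      have h0 : 0 < I.arcCost a := by linarith [I.arcCost_pos a]
      rw [← le_div_iff₀ h0, dartRate_eq]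
      exact Nat.floor_le (div_nonneg (mul_nonneg (Nat.cast_nonneg _) (Real.exp_pos _).le) h0.le)
    have h2 : ∑ a : I.graph.Dart, (I.dartRate ε t a : ℝ) * I.arcCost a ≤ M * n ^ 2 := by
      refine (Finset.sum_le_sum fun a _ => h1 a).trans ?_
      rw [← Finset.mul_sum]
      refine mul_le_mul_of_nonneg_left ((I.sum_dartWeight_le ε hε hε1 hn t).trans ?_)
        (Nat.cast_nonneg _)
      exact_mod_cast I.card_dart_le
    have h3 : ((∑ a : I.graph.Dart, I.dartRate ε t a * I.weight a.fst a.snd : ℕ) : ℝ) ≤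
        ((M * n ^ 2 : ℕ) : ℝ) := by
      push_cast
      exact h2
    exact_mod_cast h3

/-- All numbers that are sent are polynomially bounded. -/
theorem message_lt (c : ℕ) (hI : I.PolyBounded c) (hε : 0 < ε) (hε1 : ε ≤ 1) (N : ℕ)
    (hn : n < N) (hlev : levels n ≤ N) (hN : 2 ≤ N) (t : ℕ) (v : Fin n) :
    let m := Knowledge.message (I.nodeInput ε v) (I.knowledge ε t)
    m.1 < N ^ (3 * c + 10) ∧ m.2.1 < N ^ (3 * c + 10) ∧ m.2.2.1 < N ^ (3 * c + 10) ∧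
      m.2.2.2 < N ^ (3 * c + 10) := by
  classical
  obtain ⟨hid, hw, hd⟩ := hI
  have hnc : n ^ c ≤ N ^ c := Nat.pow_le_pow_left hn.le c
  have hsmall : ∀ x, x ≤ n ^ c → x < N ^ (3 * c + 10) := fun x hx =>
    (hx.trans hnc).trans_lt (Nat.pow_lt_pow_right hN (by omega))
  have hpos : 0 < N ^ (3 * c + 10) := by positivity
  rcases Nat.eq_zero_or_pos t with rfl | ht
  · have hr : (I.knowledge ε 0).round = 0 := rfl
    rw [Knowledge.message, if_pos hr]
    have h3 := abs_le.mp (hd v)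
    refine ⟨hsmall _ ?_, hsmall _ ?_, hsmall _ ?_, hsmall _ ?_⟩
    · change ((I.nodeInput ε v).edges.sup fun e => ⌈(e.2.1 : ℝ) / e.2.2⌉₊) ≤ n ^ c
      refine Finset.sup_le fun e he => ?_
      obtain ⟨u, hu, rfl⟩ := I.mem_edges.mp he
      exact (I.ceil_ratio_le hu).trans (hw _ _ hu)
    · change ((I.nodeInput ε v).edges.sup fun e => e.2.1) ≤ n ^ c
      refine Finset.sup_le fun e he => ?_
      obtain ⟨u, hu, rfl⟩ := I.mem_edges.mp he
      exact hw _ _ hu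
    · change (I.demand v).toNat ≤ _
      rw [Int.toNat_le]
      exact_mod_cast h3.2
    · change (-I.demand v).toNat ≤ _
      rw [Int.toNat_le]
      push_cast
      linarith
  · obtain ⟨s, rfl⟩ := Nat.exists_eq_add_of_le ht
    rcases lt_or_ge s (spannerRounds ε n) with hs | hs
    · obtain ⟨h1, h2, h3, -⟩ := I.knowledge_spanner ε s hs.le
      rw [I.message_of_knows_spanner ε h1 hs h2 h3]
      rcases pickEdge_mem_or (I.spannerStretch ε) (I.spanner ε s) (I.ident v)
        (I.nodeInput ε v).edges with h | h
      · obtain ⟨u, hu, he⟩ := I.mem_edges.mp h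
        rw [← he]
        exact ⟨hsmall _ (hid u), hsmall _ (hw _ _ hu), hsmall _ (hw _ _ hu.symm), hpos⟩
      · rw [h]
        exact ⟨hpos, hpos, hpos, hpos⟩
    · obtain ⟨r, rfl⟩ := Nat.exists_eq_add_of_le hs
      rw [← add_assoc]
      intro m
      have hm : m = _ := I.message_iterate ε r v
      rw [hm]
      have hNc : 1 ≤ N ^ c := Nat.one_le_pow _ _ (by omega)
      have hL : I.ratioBound ≤ N ^ c := I.ratioBound_le hNc fun u v h =>
        (I.ceil_ratio_le h).trans ((hw _ _ h).trans hnc)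
      have hW : I.weightBound ≤ N ^ c := I.weightBound_le fun u v h => (hw _ _ h).trans hnc
      have hS : ∑ a : I.graph.Dart, I.dartRate ε r a * I.weight a.fst a.snd <
          N ^ (3 * c + 10) := by
        refine (I.sum_dartRate_mul_le ε hε hε1 r).trans_lt ?_
        -- The exponent `3 * c + 4` comes from three cost factors and four factors `N`; the
        -- remaining `N ^ 6` absorbs the constant `24`.
        calc precision ε n I.ratioBound I.weightBound * n ^ 2
            ≤ (24 * (N ^ c) ^ 3 * N ^ 2) * N ^ 2 :=
              Nat.mul_le_mul (I.precision_le ε hε hn.le hlev hL hW) (Nat.pow_le_pow_left hn.le 2)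
          _ = 24 * N ^ (3 * c + 4) := by ring
          _ < 2 ^ 6 * N ^ (3 * c + 4) :=
              Nat.mul_lt_mul_of_pos_right (by norm_num) (by positivity)
          _ ≤ N ^ 6 * N ^ (3 * c + 4) :=
              Nat.mul_le_mul_right _ (Nat.pow_le_pow_left hN 6)
          _ = N ^ (3 * c + 10) := by ring
      have hle : ∀ a : I.graph.Dart, I.dartRate ε r a ≤ I.dartRate ε r a * I.weight a.fst a.snd :=
        fun a => Nat.le_mul_of_pos_right _ (I.weight_pos _ _ a.adj)
      refine ⟨lt_of_le_of_lt ?_ hS, lt_of_le_of_lt ?_ hS, lt_of_le_of_lt ?_ hS, hpos⟩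
      · exact (Finset.sum_le_sum fun a _ => hle a).trans
          (Finset.sum_le_sum_of_subset (Finset.filter_subset _ _))
      · exact (Finset.sum_le_sum fun a _ => hle a).trans
          (Finset.sum_le_sum_of_subset (Finset.filter_subset _ _))
      · exact Finset.sum_le_sum_of_subset (Finset.filter_subset _ _)

theorem levels_le : (levels n : ℝ) ≤ 2 * (1 + Real.log n) := by
  rcases Nat.eq_zero_or_pos n with rfl | hn
  · simp [levels]
  have h0 : 0 ≤ Real.log n := Real.log_natCast_nonneg n
  have h1 : (Nat.log 2 n : ℝ) ≤ Real.log n / Real.log 2 := by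
    have h3 : ((2 : ℕ) : ℝ) ^ Nat.log 2 n ≤ n := by
      exact_mod_cast Nat.pow_log_le_self 2 hn.ne'
    have h4 := Real.log_le_log (by positivity) h3
    rw [Real.log_pow] at h4
    rw [le_div_iff₀ (Real.log_pos (by norm_num))]
    exact_mod_cast h4
  have h2 : Real.log n / Real.log 2 ≤ 2 * Real.log n := by
    rw [div_le_iff₀ (Real.log_pos (by norm_num))]
    nlinarith [Real.log_two_gt_d9]
  rw [levels]
  push_cast
  linarith

/-- The width is at most `16 * X * l ^ 2`, so the iterations contribute `144 * 16 ^ 2 = 36864`. The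
other `9` covers the first round, `6` for the spanner, the ceiling and the extra iteration. The
logarithm of `lam` is only slack. -/
theorem rounds_le (hε : 0 < ε) (hε1 : ε ≤ 1) :
    (I.rounds ε : ℝ) ≤ 36873 * (1 + Real.log n) ^ 3 * ε⁻¹ ^ 3 *
      (I.lam ^ 4 * (1 + Real.log I.lam)) := by
  have hX : 1 ≤ 1 + Real.log n := by linarith [Real.log_natCast_nonneg n]
  have hlev := levels_le (n := n)
  have hE : 1 ≤ ε⁻¹ := (one_le_inv₀ hε).mpr hε1
  have hl := I.one_le_lam
  have hL := I.ratioBound_le_lam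
  set X := 1 + Real.log n with hXd
  set E := ε⁻¹ with hEd
  set l := I.lam with hld
  have hlog : 1 ≤ 1 + Real.log l := by linarith [Real.log_nonneg hl]
  have hl4 : 1 ≤ l ^ 4 := one_le_pow₀ hl
  have hX3 : 1 ≤ X ^ 3 := one_le_pow₀ hX
  have hE3 : 1 ≤ E ^ 3 := one_le_pow₀ hE
  have hXE : 1 ≤ X ^ 3 * E ^ 3 := one_le_mul_of_one_le_of_one_le hX3 hE3
  have hXEl : 1 ≤ X ^ 3 * E ^ 3 * l ^ 4 := one_le_mul_of_one_le_of_one_le hXE hl4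
  suffices h : (I.rounds ε : ℝ) ≤ 36873 * (X ^ 3 * E ^ 3 * l ^ 4) by
    refine h.trans ?_
    have := le_mul_of_one_le_right (by positivity : 0 ≤ 36873 * (X ^ 3 * E ^ 3 * l ^ 4)) hlog
    linarith
  by_cases hn : ε * n < 1
  · have h1 : (n : ℝ) ≤ E := by
      rw [hEd, ← one_div, le_div_iff₀ hε]
      linarith
    have h2 : E ≤ X ^ 3 * E ^ 3 * l ^ 4 := by
      calc E ≤ E ^ 3 := le_self_pow₀ hE (by norm_num)
        _ ≤ X ^ 3 * E ^ 3 := le_mul_of_one_le_left (by positivity) hX3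
        _ ≤ _ := le_mul_of_one_le_right (by positivity) hl4
    rw [rounds, spannerRounds, iterations, if_pos hn, if_pos hn]
    push_cast
    linarith
  · have hX2 : X ^ 2 ≤ X ^ 3 * E ^ 3 * l ^ 4 := by
      calc X ^ 2 ≤ X ^ 3 := pow_le_pow_right₀ hX (by norm_num)
        _ ≤ X ^ 3 * E ^ 3 := le_mul_of_one_le_right (by positivity) hE3
        _ ≤ _ := le_mul_of_one_le_right (by positivity) hl4
    have hR : (levels n : ℝ) * (levels n + 1) ≤ 6 * X ^ 2 := by
      calc (levels n : ℝ) * (levels n + 1) ≤ (2 * X) * (2 * X + X) := by gcongr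
        _ = _ := by ring
    have hw : width ε n I.ratioBound ≤ 16 * X * l ^ 2 := by
      rw [width, stretch, if_neg hn]
      calc 2 * (levels n : ℝ) * I.ratioBound * I.ratioBound
          ≤ 2 * (2 * X) * (2 * l) * (2 * l) := by gcongr
        _ = _ := by ring
    have hT : 144 * width ε n I.ratioBound ^ 2 * X / ε ^ 2 ≤
        36864 * (X ^ 3 * E ^ 3 * l ^ 4) := by
      have hw0 : 0 ≤ width ε n I.ratioBound := by linarith [I.one_le_width ε]
      calc 144 * width ε n I.ratioBound ^ 2 * X / ε ^ 2
          = 144 * width ε n I.ratioBound ^ 2 * X * E ^ 2 := by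
            rw [hEd, inv_pow, div_eq_mul_inv]
        _ ≤ 144 * (16 * X * l ^ 2) ^ 2 * X * E ^ 3 := by
            gcongr ?_ * ?_
            · gcongr
            · exact pow_le_pow_right₀ hE (by norm_num)
        _ = _ := by ring
    have hT' := (Nat.ceil_lt_add_one
      (by positivity : 0 ≤ 144 * width ε n I.ratioBound ^ 2 * X / ε ^ 2)).le
    rw [rounds, spannerRounds, iterations, if_neg hn, if_neg hn]
    push_cast
    linarith

end Transshipment

end BroadcastClique

theorem mainTheorem6 :
    ∃ (k : ℕ) (alg : BroadcastClique.Algorithm), ∀ c : ℕ, ∃ (d : ℕ) (C : ℝ),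
      ∀ (n : ℕ) (I : BroadcastClique.Transshipment n), I.PolyBounded c →
      ∀ ε : ℝ, 0 < ε → ε ≤ 1 →
        (∀ (t : ℕ) (v : Fin n),
          (alg.sent (alg.run I ε t v)).length ≤ d * (Nat.log 2 n + 1)) ∧
        ∃ (T : ℕ) (out : Fin n → BroadcastClique.NodeOutput),
          (T : ℝ) ≤ C * (1 + Real.log n) ^ k * ε⁻¹ ^ 3 * (I.lam ^ 4 * (1 + Real.log I.lam)) ∧
          (∀ v, alg.output (alg.run I ε T v) = some (out v)) ∧
          I.IsApproxSolution ε out := by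
  refine ⟨3, BroadcastClique.transshipmentProtocol.algorithm, fun c =>
    ⟨8 * (3 * c + 10), 36873, fun n I hI ε hε hε1 => ⟨?_, I.rounds ε, _, I.rounds_le ε hε hε1,
      BroadcastClique.transshipmentProtocol.output_run I ε _ (I.not_done ε) (I.done_rounds ε),
      I.result_isApproxSolution ε hε hε1⟩⟩⟩
  refine BroadcastClique.transshipmentProtocol.length_sent_le I ε _ (I.not_done ε)
    (I.done_rounds ε) _ fun t _ v => ?_
  -- A power of two above `n` turns the polynomial bound on the numbers into a bit length
  -- proportional to the exponent.
  obtain ⟨h1, h2, h3, h4⟩ := I.message_lt ε c hI hε hε1 (2 ^ (Nat.log 2 n + 1))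
    (Nat.lt_pow_succ_log_self (by norm_num) n) (Nat.lt_pow_self (by norm_num)).le
    (Nat.le_self_pow (by omega) 2) t v
  exact BroadcastClique.Message.length_bits_le _ _ _ _ rfl h1 h2 h3 h4
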